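/- **Setting (the BB84-INFO-$z$ protocol under a collective attack).** Let $|0^0\rangle,|1^0\rangle$ be the computational ($z$) basis of $\mathbb C^2$ and let $|0^1\rangle=\frac{|0^0\rangle+|1^0\rangle}{\sqrt2}$, $|1^1\rangle=\frac{|0^0\rangle-|1^0\rangle}{\sqrt2}$ be the $x$ basis. For a bit string $\mathbf s$, $|\mathbf s|$ is the number of its $1$-bits, and $d_H$ is the Hamming distance. Let $n,n_z,n_x\ge 1$, $N=n+n_z+n_x$, and let $v_1,\dots,v_{r+m}\in\mathbf F_2^n$ be linearly independent; $P_C$ is the $r\times n$ matrix with rows $v_1,\dots,v_r$, and $P_K$ is the $m\times n$ matrix with rows $v_{r+1},\dots,v_{r+m}$. Put $$d_{r,m}=\min_{r\le r'<r+m} d_H\bigl(v_{r'+1},\operatorname{Span}\{v_1,\dots,v_{r'}\}\bigr)\qquad(\min\emptyset=\infty).$$ Alice chooses uniformly at random a partition $\mathcal P=(\mathbf s,\mathbf z,\mathbf b)$, i.e. three strings in $\mathbf F_2^N$ with $|\mathbf s|=n$, $|\mathbf z|=n_z$, $|\mathbf b|=n_x$, $|\mathbf s+\mathbf z+\mathbf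 b|=N$, and, independently, a uniform string $\mathbf i\in\mathbf F_2^N$; she sends the qubits $|i_j^{b_j}\rangle$, $1\le j\le N$. Eve's collective attack is given by finite-dimensional probe spaces $E_j$, unit vectors $|0^E\rangle_{E_j}\in E_j$ and unitary operators $U_j$ on $E_j\otimes\mathbb C^2$, fixed before the protocol (so independent of $\mathbf i$ and $\mathcal P$): the $j$-th qubit and probe are brought into the state $U_j|0^E\rangle_{E_j}|i_j^{b_j}\rangle$, Eve keeps the probes, and the qubits go to Bob. Bob measures the $j$-th qubit in the $z$ basis if $b_j=0$ and in the $x$ basis if $b_j=1$, and obtains a string $\mathbf i^B$. Let $\mathbf c=\mathbf i+\mathbf i^B$, let $\mathbf c_{\mathbf z},\mathbf c_{\mathbf b}$ be its substrings on the positions where $z_j=1$, respectively $b_j=1$, let $\mathbf x=\mathbf i_{\mathbf s}\in\mathbf F_2^n$ be the substring of $\mathbf i$ on the positions where $s_j=1$, let $\boldsymbol\xi=\mathbf xP_C^{T}$ be the syndrome, and let $p(\mathcal P,\boldsymbol\xi,\mathbf c_{\mathbf z},\mathbf c_{\mathbf b})$ be the joint probability of these data. For $\mathbf x\in\mathbf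 F_2^n$ let $\rho_{\mathbf x}$ be the reduced state of the $n$ probes at the positions where $s_j=1$ if $\mathbf x$ was sent there (in the $z$ basis), and for $\mathbf k\in\mathbf F_2^m$ let $$\widehat\rho_{\mathbf k}=\frac1{2^{n-r-m}}\sum_{\mathbf x:\ \mathbf xP_C^T=\boldsymbol\xi,\ \mathbf xP_K^T=\mathbf k}\rho_{\mathbf x}.$$ For thresholds $p_{a,z},p_{a,x}$ define $\Delta_{\rm Eve}^{(p_{a,z},p_{a,x})}(\mathbf k,\mathbf k'\mid\mathcal P,\boldsymbol\xi,\mathbf c_{\mathbf z},\mathbf c_{\mathbf b})=\frac12\operatorname{tr}|\widehat\rho_{\mathbf k}-\widehat\rho_{\mathbf k'}|$ if $\frac{|\mathbf c_{\mathbf z}|}{n_z}\le p_{a,z}$ and $\frac{|\mathbf c_{\mathbf b}|}{n_x}\le p_{a,x}$, and $0$ otherwise, and $$\bigl\langle\Delta_{\rm Eve}^{(p_{a,z},p_{a,x})}(\mathbf k,\mathbf k')\bigr\rangle=\sum_{\mathcal P,\boldsymbol\xi,\mathbf c_{\mathbf z},\mathbf c_{\mathbf b}}\Delta_{\rm Eve}^{(p_{a,z},p_{a,x})}(\mathbf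 k,\mathbf k'\mid\mathcal P,\boldsymbol\xi,\mathbf c_{\mathbf z},\mathbf c_{\mathbf b})\;p(\mathcal P,\boldsymbol\xi,\mathbf c_{\mathbf z},\mathbf c_{\mathbf b}).$$ **Theorem.** Let $\delta>0$, $R>0$, and let, for every $n$ in some set $S\subseteq\mathbb N$ (for instance an infinite one), $v^n_1,\dots,v^n_{r_n+m_n}$ be linearly independent vectors in $\mathbf F_2^n$ such that $\delta<\frac{d_{r_n,m_n}}{n}$ and $\frac{m_n}{n}\le R$. Then for all $p_{a,z},p_{a,x}>0$ and $\epsilon_{\rm sec}>0$ with $p_{a,x}+\epsilon_{\rm sec}\le\frac\delta2$, all $n\in S$ and $n,n_z,n_x>0$, every collective attack of Eve, and any two keys $\mathbf k,\mathbf k'\in\mathbf F_2^{m_n}$, the protocol run with the vectors $v^n_1,\dots,v^n_{r_n+m_n}$ satisfies $$\bigl\langle\Delta_{\rm Eve}^{(p_{a,z},p_{a,x})}(\mathbf k,\mathbf k')\bigr\rangle\le 2R\,n\,e^{-\left(\frac{n_x}{n+n_x}\right)^2 n\,\epsilon_{\rm sec}^2}.$$ -/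

import Mathlib

open scoped BigOperators ENNReal

noncomputable section

namespace BB84InfoZ

/-! Bits are elements of `ZMod 2`, bit strings are functions `Fin t → ZMod 2`. -/

/-! ### Linear codes -/

/-- `d_{r,m} = min_{r ≤ r' < r+m} d_H(v_{r'+1}, Span {v_1, …, v_{r'}})`. The vectors are indexed from
`0` here, so `v_{r'+1}` is `v (Fin.natAdd r j)` with `r' = r + j`. The minimum of the empty
family (`m = 0`) is `⊤`. -/
def keyDist {n : ℕ} (r m : ℕ) (v : Fin (r + m) → Fin n → ZMod 2) : ℕ∞ :=
  ⨅ j : Fin m, ⨅ w ∈ Submodule.span (ZMod 2) (v '' {i | i < Fin.natAdd r j}),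
    (hammingDist (v (Fin.natAdd r j)) w : ℕ∞)

/-- The parity check matrix, whose rows are `v_1, …, v_r`. -/
def parityMatrix {n r m : ℕ} (v : Fin (r + m) → Fin n → ZMod 2) : Matrix (Fin r) (Fin n) (ZMod 2) :=
  Matrix.of fun a => v (Fin.castAdd m a)

/-- The privacy amplification matrix, whose rows are `v_{r+1}, …, v_{r+m}`. -/
def keyMatrix {n r m : ℕ} (v : Fin (r + m) → Fin n → ZMod 2) : Matrix (Fin m) (Fin n) (ZMod 2) :=
  Matrix.of fun a => v (Fin.natAdd r a)

/-! ### Qubits and collective attacks -/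

/-- The coordinates in the computational basis of the state `|i^b⟩`: `b = 0` is the `z` basis, and
for `b = 1` (the `x` basis) `|0^1⟩ = (|0⟩ + |1⟩) / √2` and `|1^1⟩ = (|0⟩ - |1⟩) / √2`. -/
def qubitState (b i : ZMod 2) : ZMod 2 → ℂ := fun t =>
  if b = 0 then (if t = i then 1 else 0)
  else (if i = 1 ∧ t = 1 then -1 else 1) / (Real.sqrt 2 : ℂ)

/-- An attack on one qubit, with probe space `ℂ^ι`: an initial unit vector `|0^E⟩` of the probe and
a unitary operator on the compound system of the probe and the qubit. -/
structure QubitAttack (ι : Type*) [Fintype ι] [DecidableEq ι] where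
  probe : ι → ℂ
  probe_unit : ∑ e, ‖probe e‖ ^ 2 = 1
  U : Matrix (ι × ZMod 2) (ι × ZMod 2) ℂ
  U_unitary : U ∈ Matrix.unitaryGroup (ι × ZMod 2) ℂ

/-- The state `U |0^E⟩ |i^b⟩` of the probe and the qubit after the attack. -/
def QubitAttack.output {ι : Type*} [Fintype ι] [DecidableEq ι] (A : QubitAttack ι)
    (b i : ZMod 2) : ι × ZMod 2 → ℂ :=
  A.U.mulVec fun p => A.probe p.1 * qubitState b i p.2

section Collective

variable {J : Type*} [Fintype J] [DecidableEq J] {ι : J → Type*} [∀ j, Fintype (ι j)]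
  [∀ j, DecidableEq (ι j)]

/-- The joint state `⨂_j U_j |0^E⟩ |i_j^{b_j}⟩` of the probes (coordinate `e`) and of
the qubits (coordinate `t`, in the computational basis) after the collective attack. -/
def jointState (A : ∀ j, QubitAttack (ι j)) (b i : J → ZMod 2) (e : ∀ j, ι j) (t : J → ZMod 2) : ℂ :=
  ∏ j, (A j).output (b j) (i j) (e j, t j)

/-- The probability (Born rule) that the measurement of all the qubits, the `j`-th one in the basis
`b_j`, gives the string `iB` if the string `i` was sent in the bases `b`. -/
def outcomeProb (A : ∀ j, QubitAttack (ι j)) (b i iB : J → ZMod 2) : ℝ :=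
  ∑ e : ∀ j, ι j,
    ‖∑ t : J → ZMod 2, star (∏ j, qubitState (b j) (iB j) (t j)) * jointState A b i e t‖ ^ 2

/-- The density matrix of the probes: the partial trace over the qubits of the joint state, if the
string `i` was sent in the bases `b`. -/
def eveState (A : ∀ j, QubitAttack (ι j)) (b i : J → ZMod 2) :
    Matrix (∀ j, ι j) (∀ j, ι j) ℂ :=
  Matrix.of fun e e' => ∑ t : J → ZMod 2, jointState A b i e t * star (jointState A b i e' t)

end Collective

/-- `tr |M|` with `|M| = √(Mᴴ M)`, that is, the sum of the square roots of the eigenvalues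
of `Mᴴ M`, with multiplicity. -/
def traceNorm {κ : Type*} [Fintype κ] [DecidableEq κ] (M : Matrix κ κ ℂ) : ℝ :=
  ∑ a, Real.sqrt ((Matrix.isHermitian_conjTranspose_mul_self M).eigenvalues a)

/-! ### The protocol -/

/-- The partitions `(s, z, b)` of the `N = n + nz + nx` positions: three `N`-bit strings
with `|s| = n`, `|z| = nz`, `|b| = nx` and `|s + z + b| = N`. -/
abbrev BitPartition (n nz nx : ℕ) : Type :=
  {P : (Fin (n + nz + nx) → ZMod 2) × (Fin (n + nz + nx) → ZMod 2) × (Fin (n + nz + nx) → ZMod 2) //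
    hammingNorm P.1 = n ∧ hammingNorm P.2.1 = nz ∧ hammingNorm P.2.2 = nx ∧
      hammingNorm (P.1 + P.2.1 + P.2.2) = n + nz + nx}

/-- The increasing enumeration of the positions of the `1`-bits of `s`. -/
def positions {N k : ℕ} (s : Fin N → ZMod 2) (h : hammingNorm s = k) : Fin k → Fin N :=
  (Finset.univ.filter fun j => s j ≠ 0).orderEmbOfFin h

section Protocol

variable {n nz nx : ℕ}

/-- The positions of the INFO bits. -/
def infoPos (P : BitPartition n nz nx) : Fin n → Fin (n + nz + nx) := positions P.1.1 P.2.1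

/-- The positions of the TEST-Z bits. -/
def testZPos (P : BitPartition n nz nx) : Fin nz → Fin (n + nz + nx) := positions P.1.2.1 P.2.2.1

/-- The positions of the TEST-X bits. -/
def testXPos (P : BitPartition n nz nx) : Fin nx → Fin (n + nz + nx) := positions P.1.2.2 P.2.2.2.1

variable {ι : Fin (n + nz + nx) → Type*} [∀ j, Fintype (ι j)] [∀ j, DecidableEq (ι j)]

/-- The probability that the partition `P = (s, z, b)` and the string `i` are chosen by Alice
(uniformly and independently) and that Bob, measuring in the bases `b`, obtains `iB`. -/
def protocolProb (A : ∀ j, QubitAttack (ι j)) (P : BitPartition n nz nx)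
    (i iB : Fin (n + nz + nx) → ZMod 2) : ℝ :=
  (Fintype.card (BitPartition n nz nx) : ℝ)⁻¹ * ((2 : ℝ) ^ (n + nz + nx))⁻¹ *
    outcomeProb A P.1.2.2 i iB

variable {r m : ℕ}

/-- `p(P, ξ, c_z, c_b)`: the probability of the partition `P`, the syndrome `ξ` of the INFO string,
and the error strings `cz` on the TEST-Z bits and `cb` on the TEST-X bits. -/
def publicProb (v : Fin (r + m) → Fin n → ZMod 2) (A : ∀ j, QubitAttack (ι j))
    (P : BitPartition n nz nx) (ξ : Fin r → ZMod 2) (cz : Fin nz → ZMod 2)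
    (cb : Fin nx → ZMod 2) : ℝ :=
  ∑ i : Fin (n + nz + nx) → ZMod 2, ∑ iB : Fin (n + nz + nx) → ZMod 2,
    if Matrix.vecMul (i ∘ infoPos P) (parityMatrix v).transpose = ξ ∧
        (i + iB) ∘ testZPos P = cz ∧ (i + iB) ∘ testXPos P = cb
    then protocolProb A P i iB else 0

/-- Eve's state on the probes of the INFO qubits given the syndrome `ξ` and the final key `k`:
`2^{-(n-r-m)} ∑ ρ_x^{b'}` over the strings `x` with syndrome `ξ` and key `k`, where `b' = b_s`. -/
def eveKeyState (v : Fin (r + m) → Fin n → ZMod 2) (A : ∀ j, QubitAttack (ι j))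
    (P : BitPartition n nz nx) (ξ : Fin r → ZMod 2) (k : Fin m → ZMod 2) :
    Matrix (∀ a, ι (infoPos P a)) (∀ a, ι (infoPos P a)) ℂ :=
  ((2 : ℂ) ^ (n - (r + m)))⁻¹ •
    ∑ x : Fin n → ZMod 2,
      if Matrix.vecMul x (parityMatrix v).transpose = ξ ∧
          Matrix.vecMul x (keyMatrix v).transpose = k
      then eveState (fun a => A (infoPos P a)) (P.1.2.2 ∘ infoPos P) x else 0

/-- `Δ_Eve(k, k' | P, ξ, c_z, c_b)`: the trace distance between Eve's states for the keys `k` and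
`k'` if the test is passed, and `0` otherwise. -/
def deltaEve (v : Fin (r + m) → Fin n → ZMod 2) (A : ∀ j, QubitAttack (ι j)) (paz pax : ℝ)
    (k k' : Fin m → ZMod 2) (P : BitPartition n nz nx) (ξ : Fin r → ZMod 2)
    (cz : Fin nz → ZMod 2) (cb : Fin nx → ZMod 2) : ℝ :=
  if (hammingNorm cz : ℝ) / nz ≤ paz ∧ (hammingNorm cb : ℝ) / nx ≤ pax
  then 1 / 2 * traceNorm (eveKeyState v A P ξ k - eveKeyState v A P ξ k') else 0

/-- The expected value `⟨Δ_Eve(k, k')⟩`. -/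
def expectedDelta (v : Fin (r + m) → Fin n → ZMod 2) (A : ∀ j, QubitAttack (ι j)) (paz pax : ℝ)
    (k k' : Fin m → ZMod 2) : ℝ :=
  ∑ P : BitPartition n nz nx, ∑ ξ : Fin r → ZMod 2, ∑ cz : Fin nz → ZMod 2,
    ∑ cb : Fin nx → ZMod 2, deltaEve v A paz pax k k' P ξ cz cb * publicProb v A P ξ cz cb

end Protocol

end BB84InfoZ

end

/-!
A purification of Eve's state for a string `x` sent in the `z` basis is a sum over error strings `c`
of the characters `(-1)^(c ⬝ᵥ x)` times mutually orthogonal components, and the squared norm of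
the component `c` is the probability of the errors `c` had the bits been sent in the `x` basis.
The difference between Eve's states for two keys is a combination of the states for the strings `x`,
whose coefficients are orthogonal to all characters of weight less than `d_{r,m}`. If `2 * t` is
less than `d_{r,m}`, the components of weight at most `t` therefore cancel, and the trace distance
is at most twice the square root of the probability of more than `t` errors in the `x` basis.

In the `x` basis the INFO bits are a random sample without replacement of the INFO and TEST-X bits,
so that, by Hoeffding's inequality, they rarely show an error rate exceeding by `ε` the one of the
TEST-X bits. The concavity of the square root moves the average over the partitions inside.
-/

noncomputable section

namespace BB84InfoZ

/-! ### Sampling without replacement -/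

lemma choose_le_choose_mul_div_pow {k M : ℕ} (h : k ≤ M) (l : ℕ) :
    (k.choose l : ℝ) ≤ M.choose l * ((k : ℝ) / M) ^ l := by
  induction l with
  | zero => simp
  | succ l ih =>
    rcases le_or_gt k l with hkl | hlk
    · rw [Nat.choose_eq_zero_of_lt (Nat.lt_succ_of_le hkl), Nat.cast_zero]
      positivity
    have hM : (0 : ℝ) < M := by exact_mod_cast (Nat.zero_le l).trans_lt (hlk.trans_le h)
    have choose_succ {a : ℕ} (ha : l ≤ a) :
        (a.choose (l + 1) : ℝ) * (l + 1) = a.choose l * (a - l) := by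
      rw [← Nat.cast_sub ha]
      exact_mod_cast Nat.choose_succ_right_eq a l
    have hratio : (k : ℝ) - l ≤ (M - l) * (k / M) := by
      have : (l : ℝ) * (k / M) ≤ l :=
        mul_le_of_le_one_right (by positivity) ((div_le_one hM).2 (by exact_mod_cast h))
      have : (M : ℝ) * (k / M) = k := by field_simp
      linarith
    have hkl : (0 : ℝ) ≤ k - l := sub_nonneg.2 (by exact_mod_cast hlk.le)
    refine le_of_mul_le_mul_right ?_ (show (0 : ℝ) < l + 1 by positivity)
    calc (k.choose (l + 1) : ℝ) * (l + 1)
        = k.choose l * (k - l) := choose_succ hlk.le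
      _ ≤ M.choose l * (k / M) ^ l * ((M - l) * (k / M)) := by gcongr
      _ = M.choose l * (M - l) * (k / M) ^ (l + 1) := by ring
      _ = M.choose (l + 1) * (k / M) ^ (l + 1) * (l + 1) := by
        rw [← choose_succ (hlk.le.trans h)]
        ring

lemma sum_powersetCard_choose_card_inter {α : Type*} [DecidableEq α] {Q K : Finset α}
    (hK : K ⊆ Q) {n l : ℕ} (hl : l ≤ n) :
    ∑ S ∈ Q.powersetCard n, (S ∩ K).card.choose l =
      K.card.choose l * (Q.card - l).choose (n - l) := by
  calc ∑ S ∈ Q.powersetCard n, (S ∩ K).card.choose l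
      = ∑ S ∈ Q.powersetCard n, ((K.powersetCard l).filter (· ⊆ S)).card := by
        refine Finset.sum_congr rfl fun S _ => ?_
        rw [← Finset.card_powersetCard]
        congr 1
        ext L
        simp only [Finset.mem_powersetCard, Finset.mem_filter, Finset.subset_inter_iff]
        tauto
    _ = ∑ L ∈ K.powersetCard l, ((Q.powersetCard n).filter (L ⊆ ·)).card := by
        simp only [Finset.card_filter]
        exact Finset.sum_comm
    _ = ∑ L ∈ K.powersetCard l, (Q.card - l).choose (n - l) := by
        refine Finset.sum_congr rfl fun L hL => ?_
        obtain ⟨hLK, rfl⟩ := Finset.mem_powersetCard.1 hL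
        exact Finset.card_filter_powersetCard_subset L Q n (hLK.trans hK) hl
    _ = K.card.choose l * (Q.card - l).choose (n - l) := by
        rw [Finset.sum_const, Finset.card_powersetCard, smul_eq_mul]

-- The generating function of the hypergeometric distribution is dominated, coefficient by
-- coefficient, by the one of the binomial distribution with the same mean.
lemma sum_powersetCard_one_add_pow_card_inter_le {α : Type*} [DecidableEq α] {Q K : Finset α}
    (hK : K ⊆ Q) (n : ℕ) {y : ℝ} (hy : 0 ≤ y) :
    ∑ S ∈ Q.powersetCard n, (1 + y) ^ (S ∩ K).card ≤
      (Q.card.choose n : ℝ) * (1 + y * ((K.card : ℝ) / Q.card)) ^ n := by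
  have expand {S : Finset α} (hS : S ∈ Q.powersetCard n) :
      (1 + y) ^ (S ∩ K).card =
        ∑ l ∈ Finset.range (n + 1), y ^ l * ((S ∩ K).card.choose l : ℝ) := by
    have hcard : (S ∩ K).card ≤ n :=
      (Finset.mem_powersetCard.1 hS).2 ▸ Finset.card_le_card Finset.inter_subset_left
    rw [add_comm, add_pow]
    simp only [one_pow, mul_one]
    refine Finset.sum_subset (Finset.range_mono (by lia)) fun l _ hl => ?_
    rw [Nat.choose_eq_zero_of_lt (by simpa using hl), Nat.cast_zero, mul_zero]
  have coeff_le {l : ℕ} (hl : l ∈ Finset.range (n + 1)) :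
      ∑ S ∈ Q.powersetCard n, ((S ∩ K).card.choose l : ℝ) ≤
        Q.card.choose n * n.choose l * ((K.card : ℝ) / Q.card) ^ l := by
    have hln : l ≤ n := Finset.mem_range_succ_iff.1 hl
    calc ∑ S ∈ Q.powersetCard n, ((S ∩ K).card.choose l : ℝ)
        = K.card.choose l * (Q.card - l).choose (n - l) := by
          exact_mod_cast sum_powersetCard_choose_card_inter hK hln
      _ ≤ Q.card.choose l * ((K.card : ℝ) / Q.card) ^ l * (Q.card - l).choose (n - l) := by
          gcongr
          exact choose_le_choose_mul_div_pow (Finset.card_le_card hK) l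
      _ = (Q.card.choose l * (Q.card - l).choose (n - l)) * ((K.card : ℝ) / Q.card) ^ l := by ring
      _ = Q.card.choose n * n.choose l * ((K.card : ℝ) / Q.card) ^ l := by
          congr 1
          exact_mod_cast (Nat.choose_mul (n := Q.card) hln).symm
  calc ∑ S ∈ Q.powersetCard n, (1 + y) ^ (S ∩ K).card
      = ∑ l ∈ Finset.range (n + 1),
          y ^ l * ∑ S ∈ Q.powersetCard n, ((S ∩ K).card.choose l : ℝ) := by
        rw [Finset.sum_congr rfl fun S hS => expand hS, Finset.sum_comm]
        simp only [Finset.mul_sum]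
    _ ≤ ∑ l ∈ Finset.range (n + 1),
          y ^ l * (Q.card.choose n * n.choose l * ((K.card : ℝ) / Q.card) ^ l) := by
        gcongr with l hl
        exact coeff_le hl
    _ = (Q.card.choose n : ℝ) * (1 + y * ((K.card : ℝ) / Q.card)) ^ n := by
        rw [add_comm (1 : ℝ), add_pow, Finset.mul_sum]
        refine Finset.sum_congr rfl fun l _ => ?_
        ring

open ProbabilityTheory in
lemma one_add_exp_sub_one_mul_le {p : ℝ} (h0 : 0 ≤ p) (h1 : p ≤ 1) (t : ℝ) :
    1 + (Real.exp t - 1) * p ≤ Real.exp (t * p + t ^ 2 / 8) := by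
  let μ : MeasureTheory.Measure ℝ := bernoulliMeasure 1 0 ⟨p, h0, h1⟩
  have integral_eq (f : ℝ → ℝ) : ∫ x, f x ∂μ = p * f 1 + (1 - p) * f 0 := by
    simp [μ, integral_bernoulliMeasure]
  have hmem : ∀ᵐ x ∂μ, x ∈ Set.Icc (0 : ℝ) 1 :=
    bernoulliMeasure_apply_of_notMem_of_notMem _ measurableSet_Icc.compl (by simp) (by simp)
  have hoeffding : p * Real.exp (t * (1 - p)) + (1 - p) * Real.exp (t * (0 - p)) ≤
      Real.exp (t ^ 2 / 8) := by
    convert (hasSubgaussianMGF_of_mem_Icc (μ := μ) measurable_id.aemeasurable hmem).mgf_le t using 2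
    · simp [mgf, integral_eq]
    · push_cast [sub_zero, nnnorm_one]
      ring
  calc 1 + (Real.exp t - 1) * p
      = Real.exp (t * p) * (p * Real.exp (t * (1 - p)) + (1 - p) * Real.exp (t * (0 - p))) := by
        rw [mul_add, mul_left_comm, mul_left_comm _ (1 - p), ← Real.exp_add, ← Real.exp_add,
          show t * p + t * (1 - p) = t by ring, show t * p + t * (0 - p) = 0 by ring, Real.exp_zero]
        ring
    _ ≤ Real.exp (t * p + t ^ 2 / 8) := by
        rw [Real.exp_add]
        gcongr

lemma sum_powersetCard_exp_mul_card_inter_le {α : Type*} [DecidableEq α] {Q K : Finset α}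
    (hK : K ⊆ Q) (n : ℕ) {t : ℝ} (ht : 0 ≤ t) :
    ∑ S ∈ Q.powersetCard n, Real.exp (t * (S ∩ K).card) ≤
      (Q.powersetCard n).card * Real.exp (n * (t * (K.card / Q.card) + t ^ 2 / 8)) := by
  have hμ0 : (0 : ℝ) ≤ K.card / Q.card := by positivity
  have hμ1 : (K.card : ℝ) / Q.card ≤ 1 :=
    div_le_one_of_le₀ (by exact_mod_cast Finset.card_le_card hK) (by positivity)
  have hy : 0 ≤ Real.exp t - 1 := sub_nonneg.2 (Real.one_le_exp ht)
  calc ∑ S ∈ Q.powersetCard n, Real.exp (t * (S ∩ K).card)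
      = ∑ S ∈ Q.powersetCard n, (1 + (Real.exp t - 1)) ^ (S ∩ K).card := by
        simp only [add_sub_cancel, ← Real.exp_nat_mul, mul_comm]
    _ ≤ (Q.powersetCard n).card * (1 + (Real.exp t - 1) * (K.card / Q.card)) ^ n := by
        rw [Finset.card_powersetCard]
        exact sum_powersetCard_one_add_pow_card_inter_le hK n hy
    _ ≤ (Q.powersetCard n).card * Real.exp (t * (K.card / Q.card) + t ^ 2 / 8) ^ n := by
        gcongr
        exact one_add_exp_sub_one_mul_le hμ0 hμ1 t
    _ = (Q.powersetCard n).card * Real.exp (n * (t * (K.card / Q.card) + t ^ 2 / 8)) := by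
        rw [Real.exp_nat_mul]

lemma card_filter_powersetCard_le {α : Type*} [DecidableEq α] {Q K : Finset α} (hK : K ⊆ Q)
    (n : ℕ) {τ : ℝ} (hτ : 0 ≤ τ) :
    (((Q.powersetCard n).filter fun S =>
        n * ((K.card : ℝ) / Q.card + τ) ≤ (S ∩ K).card).card : ℝ) ≤
      (Q.powersetCard n).card * Real.exp (-(2 * n * τ ^ 2)) := by
  set μ : ℝ := (K.card : ℝ) / Q.card
  calc (((Q.powersetCard n).filter fun S => n * (μ + τ) ≤ (S ∩ K).card).card : ℝ)
      = ∑ S ∈ Q.powersetCard n, if n * (μ + τ) ≤ (S ∩ K).card then 1 else 0 := by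
        rw [Finset.sum_boole]
    _ ≤ ∑ S ∈ Q.powersetCard n,
          Real.exp (-(4 * τ * (n * (μ + τ)))) * Real.exp (4 * τ * (S ∩ K).card) := by
        gcongr with S
        rw [← Real.exp_add]
        split_ifs with h
        · refine Real.one_le_exp ?_
          linarith [mul_le_mul_of_nonneg_left h (show 0 ≤ 4 * τ by positivity)]
        · positivity
    _ ≤ Real.exp (-(4 * τ * (n * (μ + τ)))) *
          ((Q.powersetCard n).card * Real.exp (n * (4 * τ * μ + (4 * τ) ^ 2 / 8))) := by
        rw [← Finset.mul_sum]
        gcongr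
        exact sum_powersetCard_exp_mul_card_inter_le hK n (by positivity)
    _ = (Q.powersetCard n).card * Real.exp (-(2 * n * τ ^ 2)) := by
        rw [mul_left_comm, ← Real.exp_add]
        ring_nf

lemma card_filter_powersetCard_inter_sdiff_le {α : Type*} [DecidableEq α] {Q K : Finset α}
    (hK : K ⊆ Q) {n l : ℕ} (hn : 0 < n) (hl : 0 < l) (hQ : Q.card = n + l) {ε : ℝ} (hε : 0 ≤ ε) :
    (((Q.powersetCard n).filter fun S =>
        ε ≤ ((S ∩ K).card : ℝ) / n - ((K \ S).card : ℝ) / l).card : ℝ) ≤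
      (Q.powersetCard n).card *
        Real.exp (-(2 * (((l : ℝ) / ((n : ℝ) + (l : ℝ))) ^ 2 * n * ε ^ 2))) := by
  have hn' : (0 : ℝ) < n := by exact_mod_cast hn
  have hl' : (0 : ℝ) < l := by exact_mod_cast hl
  set τ : ℝ := l / (n + l) * ε with hτ
  have card_ge {S : Finset α} (h : ε ≤ ((S ∩ K).card : ℝ) / n - ((K \ S).card : ℝ) / l) :
      n * ((K.card : ℝ) / Q.card + τ) ≤ (S ∩ K).card := by
    have hcard : (K.card : ℝ) = (S ∩ K).card + (K \ S).card := by
      rw [Finset.inter_comm]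
      exact_mod_cast (Finset.card_inter_add_card_sdiff K S).symm
    calc n * ((K.card : ℝ) / Q.card + τ)
        ≤ n * ((K.card : ℝ) / Q.card +
            l / (n + l) * (((S ∩ K).card : ℝ) / n - ((K \ S).card : ℝ) / l)) := by
          rw [hτ]
          gcongr
      _ = (S ∩ K).card := by
          rw [hcard, hQ]
          push_cast
          field_simp
          ring
  calc (((Q.powersetCard n).filter fun S =>
        ε ≤ ((S ∩ K).card : ℝ) / n - ((K \ S).card : ℝ) / l).card : ℝ)
      ≤ ((Q.powersetCard n).filter fun S =>
          n * ((K.card : ℝ) / Q.card + τ) ≤ (S ∩ K).card).card := by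
        exact_mod_cast Finset.card_le_card (Finset.monotone_filter_right _ fun S _ => card_ge)
    _ ≤ (Q.powersetCard n).card * Real.exp (-(2 * n * τ ^ 2)) :=
        card_filter_powersetCard_le hK n (by positivity)
    _ = _ := by
        rw [hτ]
        ring_nf

/-! ### The trace norm -/

section TraceNorm

open Matrix
open scoped ComplexOrder Matrix.Norms.Frobenius

variable {κ τ : Type*} [Fintype κ] [Fintype τ]

lemma frobenius_norm_sq_eq_sum (F : Matrix κ τ ℂ) : ‖F‖ ^ 2 = ∑ i, ∑ j, ‖F i j‖ ^ 2 := by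
  rw [frobenius_norm_def, ← Real.sqrt_eq_rpow, Real.sq_sqrt (by positivity)]
  simp only [Real.rpow_two]

lemma trace_conjTranspose_mul_self_eq_norm_sq (F : Matrix κ τ ℂ) :
    (Fᴴ * F).trace = (‖F‖ : ℂ) ^ 2 := by
  rw [← Complex.ofReal_pow, frobenius_norm_sq_eq_sum, Finset.sum_comm]
  simp [Matrix.trace, Matrix.mul_apply, Complex.conj_mul']

lemma norm_trace_conjTranspose_mul_le (F G : Matrix κ τ ℂ) : ‖(Fᴴ * G).trace‖ ≤ ‖F‖ * ‖G‖ := by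
  have norm_eq (H : Matrix κ τ ℂ) : ‖H‖ = √(∑ p : κ × τ, ‖H p.1 p.2‖ ^ 2) := by
    rw [← Real.sqrt_sq (norm_nonneg H), frobenius_norm_sq_eq_sum, Fintype.sum_prod_type]
  calc ‖(Fᴴ * G).trace‖ = ‖∑ p : κ × τ, star (F p.1 p.2) * G p.1 p.2‖ := by
        rw [Fintype.sum_prod_type, Finset.sum_comm]
        rfl
    _ ≤ ∑ p : κ × τ, ‖F p.1 p.2‖ * ‖G p.1 p.2‖ := by
        refine norm_sum_le_of_le _ fun p _ => ?_
        rw [norm_mul, norm_star]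
    _ ≤ ‖F‖ * ‖G‖ := by
        rw [norm_eq, norm_eq]
        exact Real.sum_mul_le_sqrt_mul_sqrt _ _ _

variable [DecidableEq κ]

lemma norm_mul_le_of_posSemidef {V : Matrix κ κ ℂ} (hV : (1 - Vᴴ * V).PosSemidef)
    (G : Matrix κ τ ℂ) : ‖V * G‖ ≤ ‖G‖ := by
  have htrace : 0 ≤ (Gᴴ * (1 - Vᴴ * V) * G).trace :=
    (hV.conjTranspose_mul_mul_same G).trace_nonneg
  have hdiff : Gᴴ * (1 - Vᴴ * V) * G = Gᴴ * G - (V * G)ᴴ * (V * G) := by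
    rw [conjTranspose_mul, Matrix.mul_sub, Matrix.sub_mul, Matrix.mul_one]
    simp only [Matrix.mul_assoc]
  rw [hdiff, trace_sub, trace_conjTranspose_mul_self_eq_norm_sq,
    trace_conjTranspose_mul_self_eq_norm_sq, sub_nonneg] at htrace
  exact (sq_le_sq₀ (norm_nonneg _) (norm_nonneg _)).1 (by exact_mod_cast htrace)

lemma norm_trace_conjTranspose_mul_mul_le {V : Matrix κ κ ℂ} (hV : (1 - Vᴴ * V).PosSemidef)
    (F G : Matrix κ τ ℂ) : ‖(Vᴴ * (F * Gᴴ)).trace‖ ≤ ‖F‖ * ‖G‖ := by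
  calc ‖(Vᴴ * (F * Gᴴ)).trace‖ = ‖((V * G)ᴴ * F).trace‖ := by
        rw [← Matrix.mul_assoc, Matrix.trace_mul_comm, ← Matrix.mul_assoc, conjTranspose_mul]
    _ ≤ ‖V * G‖ * ‖F‖ := norm_trace_conjTranspose_mul_le _ _
    _ ≤ ‖F‖ * ‖G‖ := by
        rw [mul_comm]
        gcongr
        exact norm_mul_le_of_posSemidef hV G

lemma exists_singular_values (M : Matrix κ κ ℂ) :
    ∃ (U : Matrix κ κ ℂ) (s : κ → ℝ), U * Uᴴ = 1 ∧
      (M * U)ᴴ * (M * U) = diagonal (fun a => (s a : ℂ) * s a) ∧ traceNorm M = ∑ a, s a := by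
  set hM := isHermitian_conjTranspose_mul_self M
  refine ⟨hM.eigenvectorUnitary, fun a => √(hM.eigenvalues a),
    Unitary.coe_mul_star_self hM.eigenvectorUnitary, ?_, rfl⟩
  have heigenvalues : (fun a => ((√(hM.eigenvalues a) : ℝ) : ℂ) * (√(hM.eigenvalues a) : ℝ)) =
      RCLike.ofReal ∘ hM.eigenvalues := by
    ext a
    rw [← Complex.ofReal_mul,
      Real.mul_self_sqrt ((posSemidef_conjTranspose_mul_self M).eigenvalues_nonneg a)]
    rfl
  rw [heigenvalues, ← hM.conjStarAlgAut_star_eigenvectorUnitary, Unitary.conjStarAlgAut_apply]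
  simp [star_eq_conjTranspose, Matrix.mul_assoc]

lemma exists_trace_conjTranspose_mul_eq_traceNorm (M : Matrix κ κ ℂ) :
    ∃ V : Matrix κ κ ℂ, (1 - Vᴴ * V).PosSemidef ∧ (Vᴴ * M).trace = traceNorm M := by
  obtain ⟨U, s, hUU, hspec, hsum⟩ := exists_singular_values M
  set D : Matrix κ κ ℂ := diagonal fun a => (s a : ℂ)⁻¹
  have hD : Dᴴ = D := by
    simp [D, diagonal_conjTranspose, Pi.star_def]
  -- the partial isometry of the polar decomposition of `M`; `0⁻¹ = 0` makes it vanish on the kernel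
  refine ⟨M * U * D * Uᴴ, ?_, ?_⟩
  · have hdiff : 1 - (M * U * D * Uᴴ)ᴴ * (M * U * D * Uᴴ) =
        U * diagonal (fun a => 1 - (s a : ℂ)⁻¹ * (s a * s a) * (s a : ℂ)⁻¹) * Uᴴ := by
      calc 1 - (M * U * D * Uᴴ)ᴴ * (M * U * D * Uᴴ)
          = U * Uᴴ - U * (D * ((M * U)ᴴ * (M * U)) * D) * Uᴴ := by
            simp only [hUU, conjTranspose_mul, conjTranspose_conjTranspose, hD, Matrix.mul_assoc]
        _ = U * (1 - D * ((M * U)ᴴ * (M * U)) * D) * Uᴴ := by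
            rw [Matrix.mul_sub, Matrix.sub_mul, Matrix.mul_one]
        _ = _ := by
            rw [hspec, diagonal_mul_diagonal, diagonal_mul_diagonal, ← diagonal_one, diagonal_sub]
    rw [hdiff]
    refine (PosSemidef.diagonal fun a => ?_).mul_mul_conjTranspose_same U
    rcases eq_or_ne (s a : ℂ) 0 with h0 | h0
    · simp [h0]
    · simp [h0]
  · calc ((M * U * D * Uᴴ)ᴴ * M).trace = (U * (D * (M * U)ᴴ * M)).trace := by
          simp only [conjTranspose_mul, conjTranspose_conjTranspose, hD, Matrix.mul_assoc]
      _ = (D * ((M * U)ᴴ * (M * U))).trace := by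
          rw [Matrix.trace_mul_comm]
          simp only [Matrix.mul_assoc]
      _ = ∑ a, (s a : ℂ)⁻¹ * (s a * s a) := by
          rw [hspec, diagonal_mul_diagonal, trace_diagonal]
      _ = traceNorm M := by
          rw [hsum, Complex.ofReal_sum]
          refine Finset.sum_congr rfl fun a _ => ?_
          rw [← mul_assoc, inv_mul_mul_self]

lemma traceNorm_zero : traceNorm (0 : Matrix κ κ ℂ) = 0 := by
  obtain ⟨V, -, hV⟩ := exists_trace_conjTranspose_mul_eq_traceNorm (0 : Matrix κ κ ℂ)
  rw [Matrix.mul_zero, trace_zero] at hV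
  exact_mod_cast hV.symm

lemma traceNorm_sum_smul_mul_conjTranspose_le {X : Type*} [Fintype X] {w : X → ℂ}
    {F L : X → Matrix κ τ ℂ} {η : ℝ} (hF : ∀ x, ‖F x‖ ≤ 1) (hL : ∀ x, ‖L x‖ ≤ 1)
    (hη : ∀ x, ‖F x - L x‖ ≤ η) (hcancel : ∑ x, w x • (L x * (L x)ᴴ) = 0) :
    traceNorm (∑ x, w x • (F x * (F x)ᴴ)) ≤ 2 * (∑ x, ‖w x‖) * η := by
  obtain ⟨V, hV, htrace⟩ :=
    exists_trace_conjTranspose_mul_eq_traceNorm (∑ x, w x • (F x * (F x)ᴴ))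
  have hsplit : ∑ x, w x • (F x * (F x)ᴴ) =
      ∑ x, w x • ((F x - L x) * (F x)ᴴ + L x * (F x - L x)ᴴ) := by
    rw [← sub_zero (∑ x, w x • (F x * (F x)ᴴ)), ← hcancel, ← Finset.sum_sub_distrib]
    refine Finset.sum_congr rfl fun x _ => ?_
    rw [← smul_sub, conjTranspose_sub, Matrix.sub_mul, Matrix.mul_sub, sub_add_sub_cancel]
  have hterm (x : X) :
      ‖(Vᴴ * ((F x - L x) * (F x)ᴴ + L x * (F x - L x)ᴴ)).trace‖ ≤ 2 * η := by
    rw [Matrix.mul_add, trace_add, two_mul]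
    refine norm_add_le_of_le ?_ ?_
    · exact (norm_trace_conjTranspose_mul_mul_le hV _ _).trans
        ((mul_le_of_le_one_right (norm_nonneg _) (hF x)).trans (hη x))
    · exact (norm_trace_conjTranspose_mul_mul_le hV _ _).trans
        ((mul_le_of_le_one_left (norm_nonneg _) (hL x)).trans (hη x))
  calc traceNorm (∑ x, w x • (F x * (F x)ᴴ))
      ≤ ‖(Vᴴ * ∑ x, w x • (F x * (F x)ᴴ)).trace‖ := by
        rw [htrace, Complex.norm_real]
        exact Real.le_norm_self _
    _ = ‖∑ x, w x * (Vᴴ * ((F x - L x) * (F x)ᴴ + L x * (F x - L x)ᴴ)).trace‖ := by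
        simp only [hsplit, Matrix.mul_sum, trace_sum, Matrix.mul_smul, trace_smul, smul_eq_mul]
    _ ≤ ∑ x, ‖w x‖ * (2 * η) := by
        refine norm_sum_le_of_le _ fun x _ => ?_
        rw [norm_mul]
        gcongr
        exact hterm x
    _ = 2 * (∑ x, ‖w x‖) * η := by
        rw [← Finset.sum_mul]
        ring

end TraceNorm

/-! ### Attacks on one qubit -/

/-- The character `a ↦ (-1)^a` of `ZMod 2`, in which the `x` basis and the sums over cosets of
a code are expressed. -/
def bitSign : AddChar (ZMod 2) ℂ := AddChar.zmodChar 2 (neg_one_sq (R := ℂ))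

lemma bitSign_one : bitSign 1 = -1 := by
  rw [bitSign, AddChar.zmodChar_apply, ZMod.val_one, pow_one]

lemma eq_zero_or_eq_one (a : ZMod 2) : a = 0 ∨ a = 1 := by
  decide +revert

lemma star_bitSign (a : ZMod 2) : star (bitSign a) = bitSign a := by
  rcases eq_zero_or_eq_one a with rfl | rfl <;> simp [bitSign_one]

lemma bitSign_mul_self (a : ZMod 2) : bitSign a * bitSign a = 1 := by
  rw [← AddChar.map_add_eq_mul, CharTwo.add_self_eq_zero, AddChar.map_zero_eq_one]

lemma norm_bitSign (a : ZMod 2) : ‖bitSign a‖ = 1 := by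
  rcases eq_zero_or_eq_one a with rfl | rfl <;> simp [bitSign_one]

lemma sum_zmod_two {M : Type*} [AddCommMonoid M] (f : ZMod 2 → M) : ∑ a, f a = f 0 + f 1 :=
  Fin.sum_univ_two f

lemma qubitState_zero (i t : ZMod 2) : qubitState 0 i t = if t = i then 1 else 0 := by
  simp [qubitState]

lemma qubitState_one (i t : ZMod 2) : qubitState 1 i t = bitSign (i * t) / (√2 : ℂ) := by
  rcases eq_zero_or_eq_one i with rfl | rfl <;> rcases eq_zero_or_eq_one t with rfl | rfl <;>
    simp [qubitState, bitSign_one]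

lemma norm_div_sqrt_two_sq (a : ℂ) : ‖a / (√2 : ℂ)‖ ^ 2 = ‖a‖ ^ 2 / 2 := by
  rw [norm_div, div_pow, Complex.norm_real, Real.norm_eq_abs, sq_abs, Real.sq_sqrt (by norm_num)]

lemma sum_norm_qubitState_sq (b i : ZMod 2) : ∑ t, ‖qubitState b i t‖ ^ 2 = 1 := by
  rcases eq_zero_or_eq_one b with rfl | rfl
  · simp [qubitState_zero, apply_ite]
  · simp [qubitState_one]

lemma sum_norm_sum_star_qubitState_mul_sq (b : ZMod 2) (f : ZMod 2 → ℂ) :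
    ∑ i, ‖∑ t, star (qubitState b i t) * f t‖ ^ 2 = ∑ t, ‖f t‖ ^ 2 := by
  rcases eq_zero_or_eq_one b with rfl | rfl
  · simp [qubitState_zero, apply_ite]
  · have hcoeff (i : ZMod 2) :
        ∑ t, star (qubitState 1 i t) * f t = (f 0 + bitSign i * f 1) / (√2 : ℂ) := by
      simp only [sum_zmod_two, qubitState_one, mul_zero, mul_one, AddChar.map_zero_eq_one,
        star_div₀, star_bitSign, RCLike.star_def, Complex.conj_ofReal]
      ring
    simp only [hcoeff, norm_div_sqrt_two_sq, sum_zmod_two, AddChar.map_zero_eq_one, bitSign_one,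
      one_mul, neg_one_mul, ← sub_eq_add_neg]
    linarith [parallelogram_law_with_norm ℝ (f 0) (f 1)]

section Qubit

open Matrix
open scoped Matrix.Norms.Frobenius

variable {ι : Type*} [Fintype ι] [DecidableEq ι]

/-- The state after the attack as a matrix, with rows indexed by the probe and columns by the qubit,
so that the partial trace over the qubit is the product with the conjugate transpose. -/
def QubitAttack.outputMatrix (A : QubitAttack ι) (b i : ZMod 2) : Matrix ι (ZMod 2) ℂ :=
  of fun e t => A.output b i (e, t)

lemma QubitAttack.norm_outputMatrix (A : QubitAttack ι) (b i : ZMod 2) :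
    ‖A.outputMatrix b i‖ = 1 := by
  have norm_sq_eq {κ : Type _} [Fintype κ] (ψ : κ → ℂ) :
      ((∑ p, ‖ψ p‖ ^ 2 : ℝ) : ℂ) = star ψ ⬝ᵥ ψ := by
    simp [dotProduct, Complex.conj_mul']
  have hinput : ∑ p : ι × ZMod 2, ‖A.probe p.1 * qubitState b i p.2‖ ^ 2 = 1 := by
    simp only [Fintype.sum_prod_type, norm_mul, mul_pow, ← Finset.mul_sum, sum_norm_qubitState_sq,
      mul_one, A.probe_unit]
  have hU : A.Uᴴ * A.U = 1 := Unitary.star_mul_self_of_mem A.U_unitary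
  have houtput : ∑ p, ‖A.output b i p‖ ^ 2 = 1 := by
    rw [← hinput, ← Complex.ofReal_inj, norm_sq_eq, norm_sq_eq, QubitAttack.output, star_mulVec,
      ← dotProduct_mulVec, mulVec_mulVec, hU, one_mulVec]
  rw [← sq_eq_sq₀ (norm_nonneg _) zero_le_one, frobenius_norm_sq_eq_sum, one_pow, ← houtput,
    Fintype.sum_prod_type]
  rfl

lemma QubitAttack.output_one (A : QubitAttack ι) (i : ZMod 2) (p : ι × ZMod 2) :
    A.output 1 i p = (A.output 0 0 p + bitSign i * A.output 0 1 p) / (√2 : ℂ) := by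
  have hinput : (fun p : ι × ZMod 2 => A.probe p.1 * qubitState 1 i p.2) =
      (√2 : ℂ)⁻¹ • ((fun p => A.probe p.1 * qubitState 0 0 p.2) +
        bitSign i • fun p => A.probe p.1 * qubitState 0 1 p.2) := by
    ext ⟨e, t⟩
    simp only [Pi.smul_apply, Pi.add_apply, smul_eq_mul, qubitState_one, qubitState_zero]
    rcases eq_zero_or_eq_one t with rfl | rfl
    · simp only [mul_zero, AddChar.map_zero_eq_one, one_div, ↓reduceIte, mul_one, zero_ne_one,
        add_zero]
      ring
    · simp only [mul_one, one_ne_zero, ↓reduceIte, mul_zero, zero_add]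
      ring
  rw [QubitAttack.output, hinput, mulVec_smul, mulVec_add, mulVec_smul]
  simp only [Pi.smul_apply, Pi.add_apply, smul_eq_mul, QubitAttack.output]
  ring

/-- The probability that the measurement in the basis `b` gives `iB` if the bit `i` was sent in
the same basis. -/
def QubitAttack.bitProb (A : QubitAttack ι) (b i iB : ZMod 2) : ℝ :=
  ∑ e, ‖∑ t, star (qubitState b iB t) * A.output b i (e, t)‖ ^ 2

/-- The probability of the error `c = i + iB` if a uniform bit `i` is sent and measured in
the basis `b`. -/
def QubitAttack.flipProb (A : QubitAttack ι) (b c : ZMod 2) : ℝ :=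
  1 / 2 * ∑ i, A.bitProb b i (i + c)

lemma QubitAttack.bitProb_nonneg (A : QubitAttack ι) (b i iB : ZMod 2) : 0 ≤ A.bitProb b i iB := by
  rw [QubitAttack.bitProb]
  positivity

lemma QubitAttack.flipProb_nonneg (A : QubitAttack ι) (b c : ZMod 2) : 0 ≤ A.flipProb b c :=
  mul_nonneg (by norm_num) (Finset.sum_nonneg fun _ _ => A.bitProb_nonneg _ _ _)

lemma QubitAttack.sum_bitProb (A : QubitAttack ι) (b i : ZMod 2) : ∑ iB, A.bitProb b i iB = 1 := by
  calc ∑ iB, A.bitProb b i iB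
      = ∑ e, ∑ iB, ‖∑ t, star (qubitState b iB t) * A.output b i (e, t)‖ ^ 2 := Finset.sum_comm
    _ = ∑ e, ∑ t, ‖A.output b i (e, t)‖ ^ 2 := by
        simp only [sum_norm_sum_star_qubitState_mul_sq]
    _ = ‖A.outputMatrix b i‖ ^ 2 := (frobenius_norm_sq_eq_sum _).symm
    _ = 1 := by rw [A.norm_outputMatrix, one_pow]

lemma QubitAttack.sum_flipProb (A : QubitAttack ι) (b : ZMod 2) : ∑ c, A.flipProb b c = 1 := by
  have sum_shift (i : ZMod 2) : ∑ c, A.bitProb b i (i + c) = 1 := by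
    rw [← A.sum_bitProb b i]
    exact Equiv.sum_comp (Equiv.addLeft i) (A.bitProb b i)
  simp only [QubitAttack.flipProb, ← Finset.mul_sum]
  rw [Finset.sum_comm]
  simp [sum_shift]

-- Flipping the qubit for `i = 1` turns the measurement of the error in the `x` basis into
-- the superposition of the states for `i = 0` and `i = 1`.
lemma QubitAttack.flipProb_one (A : QubitAttack ι) (c : ZMod 2) :
    A.flipProb 1 c =
      ‖A.outputMatrix 0 0 + bitSign c • (A.outputMatrix 0 1).submatrix id (· + 1)‖ ^ 2 / 4 := by
  have hamplitude (i : ZMod 2) (e : ι) :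
      ∑ t, star (qubitState 1 (i + c) t) * A.output 1 i (e, t) =
        (∑ t, star (qubitState 1 i t) * (bitSign (c * t) *
          (A.output 0 0 (e, t) + bitSign c * A.output 0 1 (e, t + 1)))) / √2 := by
    simp only [sum_zmod_two, A.output_one, qubitState_one, star_div₀, star_bitSign, RCLike.star_def,
      Complex.conj_ofReal, zero_add, CharTwo.add_self_eq_zero, mul_one, mul_zero,
      AddChar.map_zero_eq_one, AddChar.map_add_eq_mul]
    linear_combination (A.output 0 1 (e, 1) * bitSign c / (√2 : ℂ) / √2) * bitSign_mul_self i -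
      (A.output 0 1 (e, 0) * bitSign i / (√2 : ℂ) / √2) * bitSign_mul_self c
  calc A.flipProb 1 c
      = 1 / 2 * ∑ e, ∑ i, ‖∑ t, star (qubitState 1 (i + c) t) * A.output 1 i (e, t)‖ ^ 2 := by
        rw [Finset.sum_comm]
        rfl
    _ = 1 / 2 * ∑ e, (∑ t, ‖bitSign (c * t) *
          (A.output 0 0 (e, t) + bitSign c * A.output 0 1 (e, t + 1))‖ ^ 2) / 2 := by
        simp only [hamplitude, norm_div_sqrt_two_sq, ← Finset.sum_div,
          sum_norm_sum_star_qubitState_mul_sq]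
    _ = _ := by
        simp only [norm_mul, norm_bitSign, one_mul, ← Finset.sum_div, frobenius_norm_sq_eq_sum]
        simp only [QubitAttack.outputMatrix, Matrix.add_apply, Matrix.smul_apply, submatrix_apply,
          of_apply, smul_eq_mul, id]
        ring

end Qubit

section Modes

open Matrix
open scoped Matrix.Norms.Frobenius

lemma sum_bitSign_mul_smul_half_smul {κ τ : Type*} (F G : Matrix κ τ ℂ) (x : ZMod 2) :
    ∑ c, bitSign (c * x) • (1 / 2 : ℂ) • (F + bitSign c • G) = if x = 0 then F else G := by
  rcases eq_zero_or_eq_one x with rfl | rfl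
  · simp only [sum_zmod_two, mul_zero, AddChar.map_zero_eq_one, bitSign_one, if_pos]
    module
  · simp only [sum_zmod_two, mul_one, AddChar.map_zero_eq_one, bitSign_one, if_neg one_ne_zero]
    module

section Overlap

variable {κ τ : Type*} [Fintype κ] [Fintype τ]

lemma exists_purification_trace_eq_re (F G : Matrix κ τ ℂ) :
    ∃ F' G' : Matrix κ (τ ⊕ τ) ℂ, F' * F'ᴴ = F * Fᴴ ∧ G' * G'ᴴ = G * Gᴴ ∧
      (F'ᴴ * G').trace = ((Fᴴ * G).trace.re : ℂ) := by
  set ω := (Fᴴ * G).trace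
  obtain ⟨u, hu, huω⟩ : ∃ u : ℂ, u * star u = 1 ∧ u * ω = star ω := by
    rcases eq_or_ne ω 0 with hω | hω
    · exact ⟨1, by simp, by simp [hω]⟩
    · have hω' : star ω ≠ 0 := star_ne_zero.2 hω
      exact ⟨star ω / ω, by rw [star_div₀, star_star]; field_simp, by field_simp⟩
  have hsqrt : (√2 : ℂ)⁻¹ * (√2 : ℂ)⁻¹ = 1 / 2 := by
    rw [← mul_inv, ← Complex.ofReal_mul, Real.mul_self_sqrt zero_le_two]
    norm_num
  have hstar : star (√2 : ℂ)⁻¹ = (√2 : ℂ)⁻¹ := by simp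
  -- The phase `u` conjugates the overlap `ω`, so that the average over the two blocks is `ω.re`.
  refine ⟨(√2 : ℂ)⁻¹ • fromCols F F, (√2 : ℂ)⁻¹ • fromCols G (u • G), ?_, ?_, ?_⟩
  · rw [conjTranspose_smul, hstar, Matrix.smul_mul, Matrix.mul_smul, smul_smul, hsqrt,
      conjTranspose_fromCols_eq_fromRows_conjTranspose, fromCols_mul_fromRows, smul_add,
      ← add_smul, add_halves, one_smul]
  · rw [conjTranspose_smul, hstar, Matrix.smul_mul, Matrix.mul_smul, smul_smul, hsqrt,
      conjTranspose_fromCols_eq_fromRows_conjTranspose, fromCols_mul_fromRows, conjTranspose_smul,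
      Matrix.smul_mul, Matrix.mul_smul, smul_smul, hu, one_smul, smul_add, ← add_smul, add_halves,
      one_smul]
  · rw [conjTranspose_smul, hstar, Matrix.smul_mul, Matrix.mul_smul, smul_smul, hsqrt, trace_smul,
      trace_mul_comm, conjTranspose_fromCols_eq_fromRows_conjTranspose, fromCols_mul_fromRows,
      Matrix.smul_mul, trace_add, trace_smul, trace_mul_comm G, smul_eq_mul, smul_eq_mul, huω,
      RCLike.star_def, Complex.add_conj]
    push_cast
    ring

lemma trace_conjTranspose_add_bitSign_smul_mul {F G : Matrix κ τ ℂ} (hF : (Fᴴ * F).trace = 1)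
    (hG : (Gᴴ * G).trace = 1) (c c' : ZMod 2) :
    ((F + bitSign c • G)ᴴ * (F + bitSign c' • G)).trace =
      1 + bitSign c' * (Fᴴ * G).trace + bitSign c * star (Fᴴ * G).trace +
        bitSign c * bitSign c' := by
  have hGF : (Gᴴ * F).trace = star (Fᴴ * G).trace := by
    rw [← trace_conjTranspose, conjTranspose_mul, conjTranspose_conjTranspose]
  simp only [conjTranspose_add, conjTranspose_smul, star_bitSign, Matrix.add_mul, Matrix.mul_add,
    Matrix.smul_mul, Matrix.mul_smul, trace_add, trace_smul, smul_eq_mul, hF, hG, hGF]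
  ring

end Overlap

variable {ι : Type*} [Fintype ι] [DecidableEq ι]

lemma QubitAttack.exists_orthogonal_modes (A : QubitAttack ι) :
    ∃ η : ZMod 2 → Matrix ι (ZMod 2 ⊕ ZMod 2) ℂ,
      (∀ x, (∑ c, bitSign (c * x) • η c) * (∑ c, bitSign (c * x) • η c)ᴴ =
        A.outputMatrix 0 x * (A.outputMatrix 0 x)ᴴ) ∧
      ∀ c c', ((η c)ᴴ * η c').trace = if c = c' then (A.flipProb 1 c : ℂ) else 0 := by
  set F := A.outputMatrix 0 0
  set G := (A.outputMatrix 0 1).submatrix id (· + 1)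
  have hG : G * Gᴴ = A.outputMatrix 0 1 * (A.outputMatrix 0 1)ᴴ := by
    rw [conjTranspose_submatrix]
    exact submatrix_mul_equiv _ _ _ (Equiv.addRight (1 : ZMod 2)) _
  have htrace (x : ZMod 2) : (A.outputMatrix 0 x * (A.outputMatrix 0 x)ᴴ).trace = 1 := by
    rw [trace_mul_comm, trace_conjTranspose_mul_self_eq_norm_sq, A.norm_outputMatrix]
    norm_num
  obtain ⟨F', G', hF', hG', hre⟩ := exists_purification_trace_eq_re F G
  have hFF : (Fᴴ * F).trace = 1 := by rw [trace_mul_comm, htrace]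
  have hGG : (Gᴴ * G).trace = 1 := by rw [trace_mul_comm, hG, htrace]
  have hFF' : (F'ᴴ * F').trace = 1 := by rw [trace_mul_comm, hF', htrace]
  have hGG' : (G'ᴴ * G').trace = 1 := by rw [trace_mul_comm, hG', hG, htrace]
  refine ⟨fun c => (1 / 2 : ℂ) • (F' + bitSign c • G'), fun x => ?_, fun c c' => ?_⟩
  · rw [sum_bitSign_mul_smul_half_smul]
    rcases eq_zero_or_eq_one x with rfl | rfl
    · rw [if_pos rfl, hF']
    · rw [if_neg one_ne_zero, hG', hG]
  · have hflip : (A.flipProb 1 c : ℂ) = ((F + bitSign c • G)ᴴ * (F + bitSign c • G)).trace / 4 := by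
      rw [A.flipProb_one, trace_conjTranspose_mul_self_eq_norm_sq]
      push_cast
      rfl
    have hadd_conj := Complex.add_conj (Fᴴ * G).trace
    push_cast at hadd_conj
    rw [hflip, trace_conjTranspose_add_bitSign_smul_mul hFF hGG]
    simp only [conjTranspose_smul, Matrix.smul_mul, Matrix.mul_smul, smul_smul, trace_smul,
      trace_conjTranspose_add_bitSign_smul_mul hFF' hGG', hre, RCLike.star_def, Complex.conj_ofReal,
      map_div₀, map_one, map_ofNat, smul_eq_mul]
    rcases eq_or_ne c c' with rfl | hne
    · rw [if_pos rfl]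
      linear_combination -(bitSign c / 4) * hadd_conj
    · rcases eq_zero_or_eq_one c with rfl | rfl <;> rcases eq_zero_or_eq_one c' with rfl | rfl <;>
        simp [bitSign_one] at hne ⊢

end Modes

/-! ### Product distributions -/

section ProductProb

variable {J α β κ : Type*} [Fintype J] [Fintype α] [Fintype β] [Fintype κ] [DecidableEq J]
  [DecidableEq α] [DecidableEq β]

/-- The probability of the event `p` for a random function `c : J → κ` with independent values,
where `c j` has the distribution `w j`. -/
def productProb (w : J → κ → ℝ) (p : (J → κ) → Prop) [DecidablePred p] : ℝ :=
  ∑ c with p c, ∏ j, w j (c j)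

lemma productProb_nonneg {w : J → κ → ℝ} (hw : ∀ j a, 0 ≤ w j a) (p : (J → κ) → Prop)
    [DecidablePred p] : 0 ≤ productProb w p :=
  Finset.sum_nonneg fun c _ => Finset.prod_nonneg fun j _ => hw j (c j)

lemma productProb_true {w : J → κ → ℝ} (hw : ∀ j, ∑ a, w j a = 1) :
    productProb w (fun _ => True) = 1 := by
  rw [productProb, Finset.filter_true, ← Fintype.prod_sum]
  simp only [hw, Finset.prod_const_one]

lemma productProb_le_one {w : J → κ → ℝ} (hw : ∀ j a, 0 ≤ w j a) (hw_sum : ∀ j, ∑ a, w j a = 1)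
    (p : (J → κ) → Prop) [DecidablePred p] : productProb w p ≤ 1 := by
  rw [← productProb_true hw_sum, productProb, productProb, Finset.filter_true]
  exact Finset.sum_le_sum_of_subset_of_nonneg (Finset.filter_subset _ _) fun c _ _ =>
    Finset.prod_nonneg fun j _ => hw j (c j)

lemma productProb_comp_equiv (e : α ≃ J) (w : J → κ → ℝ) (p : (α → κ) → Prop) [DecidablePred p] :
    productProb w (fun c => p (c ∘ e)) = productProb (w ∘ e) p :=
  Finset.sum_equiv (e.symm.arrowCongr (Equiv.refl κ))
    (fun c => by rw [Finset.mem_filter_univ, Finset.mem_filter_univ]; rfl)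
    fun c _ => (e.prod_comp fun j => w j (c j)).symm

lemma productProb_sum_type (w : α ⊕ β → κ → ℝ) (p : (α → κ) → Prop) (q : (β → κ) → Prop)
    [DecidablePred p] [DecidablePred q] :
    productProb w (fun c => p (c ∘ Sum.inl) ∧ q (c ∘ Sum.inr)) =
      productProb (w ∘ Sum.inl) p * productProb (w ∘ Sum.inr) q := by
  rw [productProb, productProb, productProb, Finset.sum_mul_sum, ← Finset.sum_product']
  refine Finset.sum_equiv (Equiv.sumArrowEquivProdArrow α β κ) (fun c => ?_) fun c _ =>
    Fintype.prod_sum_type _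
  rw [Finset.mem_filter_univ, Finset.mem_product, Finset.mem_filter_univ, Finset.mem_filter_univ]
  rfl

lemma productProb_comp_of_injective {I : α → J} (hI : I.Injective) {w : J → κ → ℝ}
    (hw : ∀ j, ∑ a, w j a = 1) (p : (α → κ) → Prop) [DecidablePred p] :
    productProb w (fun c => p (c ∘ I)) = productProb (w ∘ I) p := by
  classical
  let e : α ⊕ {j // j ∉ Set.range I} ≃ J :=
    ((Equiv.ofInjective I hI).sumCongr (Equiv.refl _)).trans (Equiv.sumCompl (· ∈ Set.range I))
  have hmarginal := productProb_sum_type (w ∘ e) p fun _ => True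
  rw [productProb_true (w := (w ∘ e) ∘ Sum.inr) fun _ => hw _, mul_one,
    ← productProb_comp_equiv e] at hmarginal
  simp only [and_true] at hmarginal
  exact hmarginal

lemma productProb_comp_and_comp {I : α → J} {X : β → J} (hI : I.Injective) (hX : X.Injective)
    (hIX : ∀ a b, I a ≠ X b) {w : J → κ → ℝ} (hw : ∀ j, ∑ a, w j a = 1) (p : (α → κ) → Prop)
    (q : (β → κ) → Prop) [DecidablePred p] [DecidablePred q] :
    productProb w (fun c => p (c ∘ I) ∧ q (c ∘ X)) =
      productProb (w ∘ I) p * productProb (w ∘ X) q := by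
  refine (productProb_comp_of_injective (hI.sumElim hX hIX) hw fun c : α ⊕ β → κ =>
    p (c ∘ Sum.inl) ∧ q (c ∘ Sum.inr)).trans ?_
  exact productProb_sum_type _ p q

lemma sum_productProb_le {w : J → κ → ℝ} (hw : ∀ j a, 0 ≤ w j a) (hw_sum : ∀ j, ∑ a, w j a = 1)
    {ω : Type*} [Fintype ω] {p : ω → (J → κ) → Prop} [∀ x, DecidablePred (p x)]
    {C : ℝ} (hC : ∀ c, (Finset.card {x | p x c} : ℝ) ≤ C) :
    ∑ x, productProb w (p x) ≤ C := by
  have hone := productProb_true hw_sum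
  rw [productProb, Finset.filter_true] at hone
  calc ∑ x, productProb w (p x) = ∑ c, (Finset.card {x | p x c} : ℝ) * ∏ j, w j (c j) := by
        simp only [productProb, Finset.sum_filter]
        rw [Finset.sum_comm]
        simp only [← Finset.sum_filter, Finset.sum_const, nsmul_eq_mul]
    _ ≤ ∑ c : J → κ, C * ∏ j, w j (c j) := by
        gcongr with c
        exacts [Finset.prod_nonneg fun j _ => hw j (c j), hC c]
    _ = C := by rw [← Finset.mul_sum, hone, mul_one]

end ProductProb

/-! ### Collective attacks -/

section PiKronecker

open Matrix

variable {R J : Type*} [CommSemiring R] [Fintype J]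

/-- The tensor product of a family of matrices. -/
def piKronecker {κ τ : J → Type*} (F : ∀ j, Matrix (κ j) (τ j) R) :
    Matrix (∀ j, κ j) (∀ j, τ j) R :=
  of fun e t => ∏ j, F j (e j) (t j)

variable {κ τ : J → Type*}

lemma piKronecker_apply (F : ∀ j, Matrix (κ j) (τ j) R) (e : ∀ j, κ j) (t : ∀ j, τ j) :
    piKronecker F e t = ∏ j, F j (e j) (t j) :=
  rfl

lemma conjTranspose_piKronecker [StarRing R] (F : ∀ j, Matrix (κ j) (τ j) R) :
    (piKronecker F)ᴴ = piKronecker fun j => (F j)ᴴ := by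
  ext t e
  simp only [conjTranspose_apply, piKronecker_apply, star_prod]

lemma piKronecker_smul (a : J → R) (F : ∀ j, Matrix (κ j) (τ j) R) :
    (piKronecker fun j => a j • F j) = (∏ j, a j) • piKronecker F := by
  ext e t
  simp only [piKronecker_apply, Matrix.smul_apply, smul_eq_mul, Finset.prod_mul_distrib]

variable [DecidableEq J]

lemma piKronecker_sum {α : Type*} [Fintype α] (F : ∀ j, α → Matrix (κ j) (τ j) R) :
    (piKronecker fun j => ∑ a, F j a) = ∑ c : J → α, piKronecker fun j => F j (c j) := by
  ext e t
  simp only [piKronecker_apply, Matrix.sum_apply, Fintype.prod_sum]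

lemma piKronecker_mul {σ : J → Type*} [∀ j, Fintype (τ j)] (F : ∀ j, Matrix (κ j) (τ j) R)
    (G : ∀ j, Matrix (τ j) (σ j) R) :
    piKronecker F * piKronecker G = piKronecker fun j => F j * G j := by
  ext e s
  simp only [Matrix.mul_apply, piKronecker_apply, Fintype.prod_sum,
    Finset.prod_mul_distrib]

lemma trace_piKronecker [∀ j, Fintype (κ j)] (F : ∀ j, Matrix (κ j) (κ j) R) :
    (piKronecker F).trace = ∏ j, (F j).trace := by
  simp only [Matrix.trace, diag_apply, piKronecker_apply, Fintype.prod_sum]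

end PiKronecker

section Collective

open Matrix
open scoped Matrix.Norms.Frobenius

lemma norm_sum_smul_sq_of_orthogonal {α κ τ : Type*} [Fintype κ] [Fintype τ] [DecidableEq α]
    {H : α → Matrix κ τ ℂ} {p : α → ℝ} {s : α → ℂ}
    (hH : ∀ c c', ((H c)ᴴ * H c').trace = if c = c' then (p c : ℂ) else 0) (hs : ∀ c, ‖s c‖ = 1)
    (S : Finset α) : ‖∑ c ∈ S, s c • H c‖ ^ 2 = ∑ c ∈ S, p c := by
  have hss (c : α) : s c * star (s c) = 1 := by
    rw [mul_comm, RCLike.star_def, Complex.conj_mul', hs, Complex.ofReal_one, one_pow]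
  rw [← Complex.ofReal_inj, Complex.ofReal_pow, ← trace_conjTranspose_mul_self_eq_norm_sq,
    conjTranspose_sum, Matrix.sum_mul, trace_sum, Complex.ofReal_sum]
  refine Finset.sum_congr rfl fun c hc => ?_
  simp only [Matrix.mul_sum, conjTranspose_smul, Matrix.smul_mul, Matrix.mul_smul, trace_sum,
    trace_smul, hH, smul_eq_mul, mul_ite, mul_zero, Finset.sum_ite_eq, if_pos hc]
  rw [← mul_assoc, hss, one_mul]

lemma sum_smul_sum_mul_conjTranspose_eq_zero {X α κ τ : Type*} [Fintype X] [Fintype τ]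
    {w : X → ℂ} {s : α → X → ℂ} {S : Finset α}
    (hw : ∀ c ∈ S, ∀ c' ∈ S, ∑ x, w x * (s c x * star (s c' x)) = 0) (H : α → Matrix κ τ ℂ) :
    ∑ x, w x • ((∑ c ∈ S, s c x • H c) * (∑ c ∈ S, s c x • H c)ᴴ) = 0 := by
  simp only [conjTranspose_sum, conjTranspose_smul, Matrix.sum_mul, Matrix.mul_sum, Matrix.smul_mul,
    Matrix.mul_smul, Finset.smul_sum, smul_smul]
  rw [Finset.sum_comm]
  refine Finset.sum_eq_zero fun c' hc' => ?_
  rw [Finset.sum_comm]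
  refine Finset.sum_eq_zero fun c hc => ?_
  rw [← Finset.sum_smul]
  simp only [mul_comm (star _), hw c hc c' hc', zero_smul]

variable {J : Type*} [Fintype J]

lemma bitSign_dotProduct (c x : J → ZMod 2) : bitSign (c ⬝ᵥ x) = ∏ j, bitSign (c j * x j) :=
  map_prod bitSign.toMonoidHom (fun j => Multiplicative.ofAdd (c j * x j)) Finset.univ

lemma hammingNorm_add_le {β : J → Type*} [∀ j, AddZeroClass (β j)] [∀ j, DecidableEq (β j)]
    (c c' : ∀ j, β j) : hammingNorm (c + c') ≤ hammingNorm c + hammingNorm c' := by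
  classical
  rw [hammingNorm, hammingNorm, hammingNorm]
  refine (Finset.card_le_card fun j hj => ?_).trans (Finset.card_union_le _ _)
  contrapose! hj
  simp_all

variable [DecidableEq J] {ι : J → Type*} [∀ j, Fintype (ι j)]
  [∀ j, DecidableEq (ι j)]

lemma eveState_eq_mul_conjTranspose (A : ∀ j, QubitAttack (ι j)) (b i : J → ZMod 2) :
    eveState A b i = piKronecker (fun j => (A j).outputMatrix (b j) (i j)) *
      (piKronecker fun j => (A j).outputMatrix (b j) (i j))ᴴ :=
  rfl

lemma exists_joint_orthogonal_modes (A : ∀ j, QubitAttack (ι j)) :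
    ∃ H : (J → ZMod 2) → Matrix (∀ j, ι j) (J → ZMod 2 ⊕ ZMod 2) ℂ,
      (∀ x, eveState A 0 x =
        (∑ c, bitSign (c ⬝ᵥ x) • H c) * (∑ c, bitSign (c ⬝ᵥ x) • H c)ᴴ) ∧
      ∀ c c', ((H c)ᴴ * H c').trace =
        if c = c' then ((∏ j, (A j).flipProb 1 (c j) : ℝ) : ℂ) else 0 := by
  choose η hη hη_orthogonal using fun j => (A j).exists_orthogonal_modes
  refine ⟨fun c => piKronecker fun j => η j (c j), fun x => ?_, fun c c' => ?_⟩
  · have hsum : ∑ c, bitSign (c ⬝ᵥ x) • piKronecker (fun j => η j (c j)) =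
        piKronecker fun j => ∑ a, bitSign (a * x j) • η j a := by
      simp only [piKronecker_sum, piKronecker_smul, bitSign_dotProduct]
    rw [hsum, eveState_eq_mul_conjTranspose]
    simp only [conjTranspose_piKronecker, piKronecker_mul, hη, Pi.zero_apply]
  · rw [conjTranspose_piKronecker, piKronecker_mul, trace_piKronecker]
    simp only [hη_orthogonal]
    split_ifs with h
    · simp [h]
    · obtain ⟨j, hj⟩ := Function.ne_iff.1 h
      exact Finset.prod_eq_zero (Finset.mem_univ j) (if_neg hj)

/-- The probability of the event `p` for the error string `i + iB` if a uniform string `i` is sent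
and measured in the bases `b`. -/
def errorProb (A : ∀ j, QubitAttack (ι j)) (b : J → ZMod 2) (p : (J → ZMod 2) → Prop)
    [DecidablePred p] : ℝ :=
  productProb (fun j => (A j).flipProb (b j)) p

lemma errorProb_nonneg (A : ∀ j, QubitAttack (ι j)) (b : J → ZMod 2) (p : (J → ZMod 2) → Prop)
    [DecidablePred p] : 0 ≤ errorProb A b p :=
  productProb_nonneg (fun j => (A j).flipProb_nonneg (b j)) p

lemma errorProb_le_one (A : ∀ j, QubitAttack (ι j)) (b : J → ZMod 2) (p : (J → ZMod 2) → Prop)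
    [DecidablePred p] : errorProb A b p ≤ 1 :=
  productProb_le_one (fun j => (A j).flipProb_nonneg (b j)) (fun j => (A j).sum_flipProb (b j)) p

-- The errors of weight at most `t` span a low-pass approximation of the purified state. Two of them
-- differ in at most `2 * t` positions, so that its density matrix is invisible to `w`.
lemma traceNorm_sum_smul_eveState_le (A : ∀ j, QubitAttack (ι j)) {w : (J → ZMod 2) → ℂ} {t : ℝ}
    (hw : ∀ u : J → ZMod 2, (hammingNorm u : ℝ) ≤ 2 * t → ∑ x, w x * bitSign (u ⬝ᵥ x) = 0) :
    traceNorm (∑ x, w x • eveState A 0 x) ≤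
      2 * (∑ x, ‖w x‖) * √(errorProb A 1 fun c => t < (hammingNorm c : ℝ)) := by
  obtain ⟨H, hH, hH_orthogonal⟩ := exists_joint_orthogonal_modes A
  have norm_modes (p : (J → ZMod 2) → Prop) [DecidablePred p] (x : J → ZMod 2) :
      ‖∑ c with p c, bitSign (c ⬝ᵥ x) • H c‖ = √(errorProb A 1 p) :=
    (Real.sqrt_sq (norm_nonneg _)).symm.trans <| congrArg Real.sqrt <|
      norm_sum_smul_sq_of_orthogonal hH_orthogonal (fun _ => norm_bitSign _) _
  have norm_modes_le_one (p : (J → ZMod 2) → Prop) [DecidablePred p] (x : J → ZMod 2) :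
      ‖∑ c with p c, bitSign (c ⬝ᵥ x) • H c‖ ≤ 1 :=
    (norm_modes p x).trans_le (Real.sqrt_le_one.2 (errorProb_le_one A 1 p))
  simp only [hH]
  refine traceNorm_sum_smul_mul_conjTranspose_le
    (L := fun x => ∑ c with ¬ t < (hammingNorm c : ℝ), bitSign (c ⬝ᵥ x) • H c)
    (fun x => ?_) (fun x => norm_modes_le_one _ x) (fun x => ?_) ?_
  · simpa only [Finset.filter_true] using norm_modes_le_one (fun _ => True) x
  · rw [← Finset.sum_filter_add_sum_filter_not _ fun c : J → ZMod 2 => t < (hammingNorm c : ℝ),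
      add_sub_cancel_right]
    exact (norm_modes _ x).le
  · refine sum_smul_sum_mul_conjTranspose_eq_zero (fun c hc c' hc' => ?_) H
    have hadd : (hammingNorm (c + c') : ℝ) ≤ hammingNorm c + hammingNorm c' := by
      exact_mod_cast hammingNorm_add_le c c'
    rw [Finset.mem_filter_univ, not_lt] at hc hc'
    rw [← hw (c + c') (by linarith)]
    simp only [star_bitSign, ← AddChar.map_add_eq_mul, add_dotProduct]

end Collective

/-! ### Cosets of a linear code -/

section Code

open Matrix

lemma exists_forall_dotProduct_eq {K α J : Type*} [Field K] [Fintype J] {v : α → J → K}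
    (hv : LinearIndependent K v) (g : α → K) : ∃ x : J → K, ∀ a, x ⬝ᵥ v a = g a := by
  classical
  obtain ⟨f, hf⟩ := ((Module.Basis.span hv).constr K g).exists_extend
  refine ⟨(dotProductEquiv K J).symm f, fun a => ?_⟩
  calc (dotProductEquiv K J).symm f ⬝ᵥ v a = f (v a) :=
        LinearMap.congr_fun ((dotProductEquiv K J).apply_symm_apply f) (v a)
    _ = (f ∘ₗ (Submodule.span K (Set.range v)).subtype) (Module.Basis.span hv a) := by
        rw [LinearMap.comp_apply, Submodule.subtype_apply, Module.Basis.span_apply]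
    _ = g a := by rw [hf, Module.Basis.constr_basis]

variable {n q : ℕ}

/-- The strings with the values `g` of the parities given by `v`. -/
def parityCoset (v : Fin q → Fin n → ZMod 2) (g : Fin q → ZMod 2) : Finset (Fin n → ZMod 2) :=
  {x | ∀ a, x ⬝ᵥ v a = g a}

lemma mem_parityCoset {v : Fin q → Fin n → ZMod 2} {g : Fin q → ZMod 2} {x : Fin n → ZMod 2} :
    x ∈ parityCoset v g ↔ ∀ a, x ⬝ᵥ v a = g a :=
  Finset.mem_filter_univ x

lemma sum_parityCoset_eq_of_shift {v : Fin q → Fin n → ZMod 2} {g g' : Fin q → ZMod 2}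
    {M : Type*} [AddCommMonoid M] {f : (Fin n → ZMod 2) → M} {x₀ : Fin n → ZMod 2}
    (hx₀ : ∀ a, x₀ ⬝ᵥ v a = g' a - g a) (hf : ∀ x, f (x + x₀) = f x) :
    ∑ x ∈ parityCoset v g, f x = ∑ x ∈ parityCoset v g', f x := by
  refine Finset.sum_equiv (Equiv.addRight x₀) (fun x => ?_) fun x _ => (hf x).symm
  simp only [mem_parityCoset, Equiv.coe_addRight, add_dotProduct, hx₀, add_sub_left_comm _ (g' _),
    add_eq_left, sub_eq_zero]

lemma card_parityCoset {v : Fin q → Fin n → ZMod 2} (hv : LinearIndependent (ZMod 2) v)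
    (g : Fin q → ZMod 2) : (parityCoset v g).card = 2 ^ (n - q) := by
  have hq : q ≤ n := by simpa using hv.fintype_card_le_finrank
  have hcard (g' : Fin q → ZMod 2) : (parityCoset v g').card = (parityCoset v g).card := by
    obtain ⟨x₀, hx₀⟩ := exists_forall_dotProduct_eq hv (g - g')
    rw [Finset.card_eq_sum_ones, Finset.card_eq_sum_ones]
    exact sum_parityCoset_eq_of_shift hx₀ fun _ => rfl
  have hfibers : 2 ^ n = ∑ g' : Fin q → ZMod 2, (parityCoset v g').card := by
    calc 2 ^ n = (Finset.univ : Finset (Fin n → ZMod 2)).card := by simp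
      _ = ∑ g' : Fin q → ZMod 2, (Finset.univ.filter fun x => (fun a => x ⬝ᵥ v a) = g').card :=
          Finset.card_eq_sum_card_fiberwise (by simp)
      _ = ∑ g' : Fin q → ZMod 2, (parityCoset v g').card := by
          simp only [parityCoset, funext_iff]
  have hpow : 2 ^ n = 2 ^ q * (parityCoset v g).card := by
    rw [hfibers, Finset.sum_congr rfl fun g' _ => hcard g']
    simp
  have hsplit : 2 ^ n = 2 ^ q * 2 ^ (n - q) := by rw [← pow_add, Nat.add_sub_cancel' hq]
  exact Nat.eq_of_mul_eq_mul_left (by positivity) (hpow.symm.trans hsplit)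

variable {r m : ℕ} {v : Fin (r + m) → Fin n → ZMod 2}

lemma keyDist_le_hammingNorm_add (j : Fin m) {z : Fin n → ZMod 2}
    (hz : z ∈ Submodule.span (ZMod 2) (v '' {i | i < Fin.natAdd r j})) :
    keyDist r m v ≤ hammingNorm (v (Fin.natAdd r j) + z) := by
  have hneg : v (Fin.natAdd r j) = -v (Fin.natAdd r j) := funext fun _ => (CharTwo.neg_eq _).symm
  rw [hneg, ← hammingDist_eq_hammingNorm]
  exact iInf_le_of_le j (iInf₂_le z hz)

-- A nonzero coefficient at `v (Fin.natAdd r j)`, for the largest such `j`, would give `u` at least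
-- the weight `keyDist r m v`.
lemma mem_span_image_lt_of_hammingNorm_lt_keyDist {u : Fin n → ZMod 2}
    (hu : (hammingNorm u : ℕ∞) < keyDist r m v)
    (hspan : u ∈ Submodule.span (ZMod 2) (Set.range v)) :
    u ∈ Submodule.span (ZMod 2) (v '' {i | (i : ℕ) < r}) := by
  have descend : ∀ s ≤ m, u ∈ Submodule.span (ZMod 2) (v '' {i | (i : ℕ) < r + s}) →
      u ∈ Submodule.span (ZMod 2) (v '' {i | (i : ℕ) < r}) := by
    intro s
    induction s with
    | zero => exact fun _ => id
    | succ s ih =>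
      intro hs hmem
      set j : Fin m := ⟨s, hs⟩
      have hinsert : {i : Fin (r + m) | (i : ℕ) < r + (s + 1)} =
          insert (Fin.natAdd r j) {i | i < Fin.natAdd r j} := by
        ext i
        simp only [Set.mem_ofPred_eq, Set.mem_insert_iff, Fin.ext_iff, Fin.lt_def,
          Fin.val_natAdd, j]
        omega
      rw [hinsert, Set.image_insert_eq, Submodule.mem_span_insert] at hmem
      obtain ⟨a, z, hz, rfl⟩ := hmem
      rcases eq_zero_or_eq_one a with rfl | rfl
      · rw [zero_smul, zero_add]
        rw [zero_smul, zero_add] at ih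
        exact ih (by omega) hz
      · rw [one_smul] at hu
        exact absurd (keyDist_le_hammingNorm_add j hz) (not_le.2 hu)
  refine descend m le_rfl ?_
  rwa [Set.eq_univ_of_forall (s := {i : Fin (r + m) | (i : ℕ) < r + m}) fun i => i.isLt,
    Set.image_univ]

lemma exists_shift_of_hammingNorm_lt_keyDist (hv : LinearIndependent (ZMod 2) v)
    {u : Fin n → ZMod 2} (hu : (hammingNorm u : ℕ∞) < keyDist r m v) {g : Fin (r + m) → ZMod 2}
    (hg : ∀ i : Fin (r + m), (i : ℕ) < r → g i = 0) :
    ∃ x₀, (∀ i, x₀ ⬝ᵥ v i = g i) ∧ u ⬝ᵥ x₀ = 0 := by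
  by_cases hspan : u ∈ Submodule.span (ZMod 2) (Set.range v)
  · obtain ⟨x₀, hx₀⟩ := exists_forall_dotProduct_eq hv g
    refine ⟨x₀, hx₀, ?_⟩
    have hfirst := mem_span_image_lt_of_hammingNorm_lt_keyDist hu hspan
    clear hu hspan
    induction hfirst using Submodule.span_induction with
    | mem y hy =>
      obtain ⟨i, hi, rfl⟩ := hy
      rw [dotProduct_comm, hx₀, hg i hi]
    | zero => exact zero_dotProduct x₀
    | add y z _ _ hy hz => rw [add_dotProduct, hy, hz, add_zero]
    | smul a y _ hy => rw [smul_dotProduct, hy, smul_zero]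
  · obtain ⟨x₀, hx₀⟩ := exists_forall_dotProduct_eq (linearIndependent_finCons.2 ⟨hv, hspan⟩)
      (Fin.cons 0 g : Fin (r + m + 1) → ZMod 2)
    refine ⟨x₀, fun i => by simpa using hx₀ i.succ, ?_⟩
    simpa [dotProduct_comm] using hx₀ 0

lemma sum_parityCoset_bitSign_eq (hv : LinearIndependent (ZMod 2) v) {u : Fin n → ZMod 2}
    (hu : (hammingNorm u : ℕ∞) < keyDist r m v) (ξ : Fin r → ZMod 2) (k k' : Fin m → ZMod 2) :
    ∑ x ∈ parityCoset v (Fin.append ξ k), bitSign (u ⬝ᵥ x) =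
      ∑ x ∈ parityCoset v (Fin.append ξ k'), bitSign (u ⬝ᵥ x) := by
  have hsyndrome (i : Fin (r + m)) (hi : (i : ℕ) < r) :
      Fin.append ξ k' i - Fin.append ξ k i = 0 := by
    rw [← Fin.castAdd_castLT m i hi, Fin.append_left, Fin.append_left, sub_self]
  obtain ⟨x₀, hx₀, hux₀⟩ := exists_shift_of_hammingNorm_lt_keyDist hv hu hsyndrome
  exact sum_parityCoset_eq_of_shift hx₀ fun x => by rw [dotProduct_add, hux₀, add_zero]

lemma traceNorm_sum_parityCoset_sub_le {ι : Fin n → Type*} [∀ j, Fintype (ι j)]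
    [∀ j, DecidableEq (ι j)] (hv : LinearIndependent (ZMod 2) v) (A : ∀ j, QubitAttack (ι j))
    {t : ℝ} (ht : ∀ u : Fin n → ZMod 2, (hammingNorm u : ℝ) ≤ 2 * t →
      (hammingNorm u : ℕ∞) < keyDist r m v) (ξ : Fin r → ZMod 2) (k k' : Fin m → ZMod 2) :
    traceNorm (((2 : ℂ) ^ (n - (r + m)))⁻¹ • ∑ x ∈ parityCoset v (Fin.append ξ k), eveState A 0 x -
        ((2 : ℂ) ^ (n - (r + m)))⁻¹ • ∑ x ∈ parityCoset v (Fin.append ξ k'), eveState A 0 x) ≤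
      4 * √(errorProb A 1 fun c => t < (hammingNorm c : ℝ)) := by
  set N : ℂ := 2 ^ (n - (r + m)) with hN
  set coset : (Fin m → ZMod 2) → Finset (Fin n → ZMod 2) := fun k => parityCoset v (Fin.append ξ k)
  set w : (Fin n → ZMod 2) → ℂ := fun x =>
    (if x ∈ coset k then N⁻¹ else 0) - if x ∈ coset k' then N⁻¹ else 0 with hw_def
  have hcoset (k : Fin m → ZMod 2) : ∑ x, ‖if x ∈ coset k then N⁻¹ else 0‖ = 1 := by
    simp only [apply_ite norm, norm_zero, Finset.sum_ite_mem, Finset.univ_inter, Finset.sum_const,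
      coset, card_parityCoset hv, hN, nsmul_eq_mul, norm_inv, norm_pow, Complex.norm_ofNat]
    push_cast
    exact mul_inv_cancel₀ (by positivity)
  have hw_norm : ∑ x, ‖w x‖ ≤ 2 := by
    refine (Finset.sum_le_sum fun x _ => norm_sub_le _ _).trans ?_
    rw [Finset.sum_add_distrib, hcoset, hcoset]
    norm_num
  have hw (u : Fin n → ZMod 2) (hu : (hammingNorm u : ℝ) ≤ 2 * t) :
      ∑ x, w x * bitSign (u ⬝ᵥ x) = 0 := by
    simp only [hw_def, sub_mul, ite_mul, zero_mul, Finset.sum_sub_distrib, Finset.sum_ite_mem,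
      Finset.univ_inter, ← Finset.mul_sum]
    rw [sum_parityCoset_bitSign_eq hv (ht u hu) ξ k k', sub_self]
  have hstate : N⁻¹ • ∑ x ∈ coset k, eveState A 0 x - N⁻¹ • ∑ x ∈ coset k', eveState A 0 x =
      ∑ x, w x • eveState A 0 x := by
    simp only [hw_def, sub_smul, ite_smul, zero_smul, Finset.sum_sub_distrib, Finset.sum_ite_mem,
      Finset.univ_inter, Finset.smul_sum]
  rw [hstate]
  refine (traceNorm_sum_smul_eveState_le A hw).trans ?_
  gcongr
  linarith

end Code

/-! ### Random partitions -/

section Partition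

section Ones

variable {N : ℕ}

/-- The set of the positions of the `1`-bits of `s`. -/
def ones (s : Fin N → ZMod 2) : Finset (Fin N) := {j | s j ≠ 0}

lemma mem_ones {s : Fin N → ZMod 2} {j : Fin N} : j ∈ ones s ↔ s j ≠ 0 :=
  Finset.mem_filter_univ j

lemma ones_injective : Function.Injective (ones (N := N)) := by
  intro s s' h
  funext j
  have hj : s j ≠ 0 ↔ s' j ≠ 0 := by rw [← mem_ones, h, mem_ones]
  rcases eq_zero_or_eq_one (s j) with hs | hs <;> rcases eq_zero_or_eq_one (s' j) with hs' | hs' <;>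
    simp_all

lemma exists_ones_eq (S : Finset (Fin N)) : ∃ s : Fin N → ZMod 2, ones s = S :=
  ⟨fun j => if j ∈ S then 1 else 0, by ext; simp [mem_ones]⟩

lemma positions_injective {k : ℕ} (s : Fin N → ZMod 2) (h : hammingNorm s = k) :
    Function.Injective (positions s h) :=
  (Finset.orderEmbOfFin _ h).injective

lemma positions_mem_ones {k : ℕ} (s : Fin N → ZMod 2) (h : hammingNorm s = k) (a : Fin k) :
    positions s h a ∈ ones s :=
  Finset.orderEmbOfFin_mem _ h a

lemma hammingNorm_comp_positions {k : ℕ} (s : Fin N → ZMod 2) (h : hammingNorm s = k)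
    (c : Fin N → ZMod 2) : hammingNorm (c ∘ positions s h) = (ones s ∩ ones c).card := by
  have himage : Finset.univ.image (positions s h) = ones s :=
    Finset.image_orderEmbOfFin_univ _ h
  rw [← himage, ← Finset.filter_mem_eq_inter, Finset.filter_image,
    Finset.card_image_of_injective _ (positions_injective s h)]
  simp only [mem_ones, hammingNorm, Function.comp_apply]

lemma hammingNorm_eq_sum_val (s : Fin N → ZMod 2) : hammingNorm s = ∑ j, (s j).val := by
  rw [hammingNorm, Finset.card_filter]
  refine Finset.sum_congr rfl fun j _ => ?_
  rcases eq_zero_or_eq_one (s j) with hs | hs <;> simp [hs, ZMod.val_one]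

end Ones

variable {n nz nx : ℕ}

namespace BitPartition

lemma val_add_val_add_val (P : BitPartition n nz nx) (j : Fin (n + nz + nx)) :
    (P.1.1 j).val + (P.1.2.1 j).val + (P.1.2.2 j).val = 1 := by
  obtain ⟨⟨s, z, b⟩, hs, hz, hb, hsum⟩ := P
  dsimp only at hs hz hb hsum ⊢
  have hcover (j : Fin (n + nz + nx)) : 1 ≤ (s j).val + (z j).val + (b j).val := by
    have hj : (s + z + b) j ≠ 0 :=
      Finset.filter_card_eq (hsum.trans (Finset.card_fin _).symm) j (Finset.mem_univ j)
    contrapose! hj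
    simp_all
  have htotal : ∑ _j : Fin (n + nz + nx), 1 = ∑ j, ((s j).val + (z j).val + (b j).val) := by
    rw [Finset.sum_add_distrib, Finset.sum_add_distrib, ← hammingNorm_eq_sum_val,
      ← hammingNorm_eq_sum_val, ← hammingNorm_eq_sum_val, hs, hz, hb]
    simp
  exact ((Finset.sum_eq_sum_iff_of_le fun j _ => hcover j).1 htotal j (Finset.mem_univ j)).symm

lemma ones_info_subset (P : BitPartition n nz nx) : ones P.1.1 ⊆ (ones P.1.2.1)ᶜ := by
  intro j hj
  have hval := P.val_add_val_add_val j
  rw [Finset.mem_compl, mem_ones]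
  rw [mem_ones] at hj
  rw [← ZMod.val_ne_zero] at hj ⊢
  omega

lemma ones_testX (P : BitPartition n nz nx) : ones P.1.2.2 = (ones P.1.2.1)ᶜ \ ones P.1.1 := by
  ext j
  have hval := P.val_add_val_add_val j
  rw [Finset.mem_sdiff, Finset.mem_compl, mem_ones, mem_ones, mem_ones, ← ZMod.val_ne_zero,
    ← ZMod.val_ne_zero, ← ZMod.val_ne_zero]
  omega

lemma card_compl_ones_testZ (P : BitPartition n nz nx) : (ones P.1.2.1)ᶜ.card = n + nx := by
  have hz : (ones P.1.2.1).card = nz := P.2.2.1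
  rw [Finset.card_compl, hz, Fintype.card_fin]
  omega

lemma testX_comp_infoPos (P : BitPartition n nz nx) : P.1.2.2 ∘ infoPos P = 0 := by
  funext a
  have ha : infoPos P a ∉ ones P.1.2.2 := by
    rw [ones_testX, Finset.mem_sdiff, not_and_not_right]
    exact fun _ => positions_mem_ones _ P.2.1 a
  exact not_not.1 (mt (mem_ones (s := P.1.2.2)).2 ha)

lemma testX_comp_testXPos (P : BitPartition n nz nx) : P.1.2.2 ∘ testXPos P = 1 :=
  funext fun a => (eq_zero_or_eq_one _).resolve_left <|
    (mem_ones (s := P.1.2.2)).1 (positions_mem_ones _ P.2.2.2.1 a)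

lemma infoPos_ne_testXPos (P : BitPartition n nz nx) (a : Fin n) (a' : Fin nx) :
    infoPos P a ≠ testXPos P a' := fun h => by
  have h0 := congrFun P.testX_comp_infoPos a
  have h1 := congrFun P.testX_comp_testXPos a'
  rw [Function.comp_apply, h] at h0
  exact zero_ne_one (h0.symm.trans h1)

lemma exists_ones_eq_and_testZ_eq (P₀ : BitPartition n nz nx) {S : Finset (Fin (n + nz + nx))}
    (hS : S ⊆ (ones P₀.1.2.1)ᶜ) (hcard : S.card = n) :
    ∃ P : BitPartition n nz nx, ones P.1.1 = S ∧ P.1.2.1 = P₀.1.2.1 := by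
  obtain ⟨s, rfl⟩ := exists_ones_eq S
  set z := P₀.1.2.1
  have hz : hammingNorm z = nz := P₀.2.2.1
  have hval (j : Fin (n + nz + nx)) :
      (s j).val + (z j).val + ((1 + s + z : Fin (n + nz + nx) → ZMod 2) j).val = 1 := by
    have hdisj : s j ≠ 0 → z j = 0 := by
      simpa only [mem_ones, Finset.mem_compl, not_not] using @hS j
    rw [Pi.add_apply, Pi.add_apply, Pi.one_apply]
    generalize s j = a, z j = b at *
    decide +revert
  have htotal : hammingNorm s + hammingNorm z + hammingNorm (1 + s + z) = n + nz + nx := by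
    simp only [hammingNorm_eq_sum_val, ← Finset.sum_add_distrib, hval]
    simp
  have hone : s + z + (1 + s + z) = 1 := by
    funext j
    simp only [Pi.add_apply, Pi.one_apply]
    generalize s j = a, z j = b
    decide +revert
  refine ⟨⟨(s, z, 1 + s + z), hcard, hz, ?_, ?_⟩, rfl, rfl⟩
  · have hs : hammingNorm s = n := hcard
    dsimp only
    omega
  · dsimp only
    rw [hone]
    simp [hammingNorm]

lemma card_filter_testZ_eq (P₀ : BitPartition n nz nx) (p : Finset (Fin (n + nz + nx)) → Prop)
    [DecidablePred p] :
    (Finset.univ.filter fun P : BitPartition n nz nx =>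
        P.1.2.1 = P₀.1.2.1 ∧ p (ones P.1.1)).card =
      (((ones P₀.1.2.1)ᶜ.powersetCard n).filter p).card := by
  refine Finset.card_bij (fun P _ => ones P.1.1) (fun P hP => ?_) (fun P hP P' hP' h => ?_)
    fun S hS => ?_
  · obtain ⟨hz, hp⟩ := (Finset.mem_filter_univ P).1 hP
    exact Finset.mem_filter.2 ⟨Finset.mem_powersetCard.2 ⟨hz ▸ P.ones_info_subset, P.2.1⟩, hp⟩
  · have hz := ((Finset.mem_filter_univ P).1 hP).1.trans ((Finset.mem_filter_univ P').1 hP').1.symm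
    have hb : P.1.2.2 = P'.1.2.2 := ones_injective (by rw [ones_testX, ones_testX, hz, h])
    exact Subtype.ext (Prod.ext (ones_injective h) (Prod.ext hz hb))
  · obtain ⟨hSz, hp⟩ := Finset.mem_filter.1 hS
    obtain ⟨hsubset, hcard⟩ := Finset.mem_powersetCard.1 hSz
    obtain ⟨P, rfl, hz⟩ := P₀.exists_ones_eq_and_testZ_eq hsubset hcard
    exact ⟨P, (Finset.mem_filter_univ P).2 ⟨hz, hp⟩, rfl⟩

/-- The excess of the error rate of `c` on the INFO bits over the one on the TEST-X bits. -/
def errorRateExcess (P : BitPartition n nz nx) (c : Fin (n + nz + nx) → ZMod 2) : ℝ :=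
  (hammingNorm (c ∘ infoPos P) : ℝ) / n - (hammingNorm (c ∘ testXPos P) : ℝ) / nx

lemma errorRateExcess_eq (P : BitPartition n nz nx) (c : Fin (n + nz + nx) → ZMod 2) :
    P.errorRateExcess c = ((ones P.1.1 ∩ ((ones P.1.2.1)ᶜ ∩ ones c)).card : ℝ) / n -
      ((((ones P.1.2.1)ᶜ ∩ ones c) \ ones P.1.1).card : ℝ) / nx := by
  rw [errorRateExcess, infoPos, testXPos, hammingNorm_comp_positions, hammingNorm_comp_positions,
    ← Finset.inter_assoc, Finset.inter_eq_left.2 P.ones_info_subset, ones_testX,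
    Finset.sdiff_inter_right_comm]

lemma card_filter_testZ_eq_and_le_errorRateExcess_le (hn : 0 < n) (hnx : 0 < nx) {ε : ℝ}
    (hε : 0 ≤ ε) (c z : Fin (n + nz + nx) → ZMod 2) :
    ((Finset.univ.filter fun P : BitPartition n nz nx =>
        P.1.2.1 = z ∧ ε ≤ P.errorRateExcess c).card : ℝ) ≤
      (Finset.univ.filter fun P : BitPartition n nz nx => P.1.2.1 = z).card *
        Real.exp (-(2 * (((nx : ℝ) / (n + nx)) ^ 2 * n * ε ^ 2))) := by
  by_cases hz : ∃ P₀ : BitPartition n nz nx, P₀.1.2.1 = z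
  · obtain ⟨P₀, rfl⟩ := hz
    set K := (ones P₀.1.2.1)ᶜ ∩ ones c
    have hexcess (P : BitPartition n nz nx) : P.1.2.1 = P₀.1.2.1 ∧ ε ≤ P.errorRateExcess c ↔
        P.1.2.1 = P₀.1.2.1 ∧
          ε ≤ ((ones P.1.1 ∩ K).card : ℝ) / n - ((K \ ones P.1.1).card : ℝ) / nx :=
      and_congr_right fun hz => by rw [errorRateExcess_eq, hz]
    have hall := card_filter_testZ_eq P₀ fun _ => True
    simp only [and_true, Finset.filter_true] at hall
    simp only [hexcess]
    rw [card_filter_testZ_eq P₀ fun S => ε ≤ ((S ∩ K).card : ℝ) / n - ((K \ S).card : ℝ) / nx, hall]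
    exact card_filter_powersetCard_inter_sdiff_le Finset.inter_subset_left hn hnx
      P₀.card_compl_ones_testZ hε
  · rw [Finset.filter_eq_empty_iff.2 fun P _ h => hz ⟨P, h.1⟩, Finset.card_empty, Nat.cast_zero]
    positivity

lemma card_filter_le_errorRateExcess_le (hn : 0 < n) (hnx : 0 < nx) {ε : ℝ} (hε : 0 ≤ ε)
    (c : Fin (n + nz + nx) → ZMod 2) :
    ((Finset.univ.filter fun P : BitPartition n nz nx => ε ≤ P.errorRateExcess c).card : ℝ) ≤
      Fintype.card (BitPartition n nz nx) *
        Real.exp (-(2 * (((nx : ℝ) / (n + nx)) ^ 2 * n * ε ^ 2))) := by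
  rw [← Finset.card_univ, Finset.card_eq_sum_card_fiberwise (t := Finset.univ)
      (f := fun P : BitPartition n nz nx => P.1.2.1) (by simp),
    Finset.card_eq_sum_card_fiberwise (s := Finset.univ) (t := Finset.univ)
      (f := fun P : BitPartition n nz nx => P.1.2.1) (by simp)]
  push_cast
  rw [Finset.sum_mul]
  refine Finset.sum_le_sum fun z _ => ?_
  simp only [Finset.filter_filter, and_comm (b := _ = z)]
  exact card_filter_testZ_eq_and_le_errorRateExcess_le hn hnx hε c z

end BitPartition

end Partition

/-! ### The expected trace distance -/

section Protocol

lemma outcomeProb_eq_prod {J : Type*} [Fintype J] [DecidableEq J] {ι : J → Type*}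
    [∀ j, Fintype (ι j)] [∀ j, DecidableEq (ι j)] (A : ∀ j, QubitAttack (ι j))
    (b i iB : J → ZMod 2) :
    outcomeProb A b i iB = ∏ j, (A j).bitProb (b j) (i j) (iB j) := by
  simp only [QubitAttack.bitProb, Fintype.prod_sum, Finset.prod_pow, ← norm_prod, outcomeProb,
    star_prod, jointState, ← Finset.prod_mul_distrib]

lemma sum_ite_sum_ite_eq {T U M : Type*} [Fintype T] [Fintype U] [DecidableEq T] [AddCommMonoid M]
    (p : T → Prop) [DecidablePred p] (f : U → T) (w : U → M) :
    (∑ t, if p t then ∑ u, if f u = t then w u else 0 else 0) =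
      ∑ u, if p (f u) then w u else 0 := by
  simp only [← Finset.sum_filter]
  rw [← Finset.sum_fiberwise_of_maps_to (t := Finset.univ.filter p) (g := f) (by simp)]
  refine Finset.sum_congr rfl fun t ht => Finset.sum_congr ?_ fun _ _ => rfl
  rw [Finset.mem_filter_univ] at ht
  ext u
  simp only [Finset.mem_filter, Finset.mem_univ, true_and, iff_and_self]
  rintro rfl
  exact ht

variable {n nz nx : ℕ} {ι : Fin (n + nz + nx) → Type*} [∀ j, Fintype (ι j)]
  [∀ j, DecidableEq (ι j)] {r m : ℕ}

lemma publicProb_nonneg (v : Fin (r + m) → Fin n → ZMod 2) (A : ∀ j, QubitAttack (ι j))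
    (P : BitPartition n nz nx) (ξ : Fin r → ZMod 2) (cz : Fin nz → ZMod 2)
    (cb : Fin nx → ZMod 2) : 0 ≤ publicProb v A P ξ cz cb := by
  refine Finset.sum_nonneg fun i _ => Finset.sum_nonneg fun iB _ => ?_
  split_ifs
  · rw [protocolProb, outcomeProb_eq_prod]
    exact mul_nonneg (by positivity) (Finset.prod_nonneg fun j _ => (A j).bitProb_nonneg _ _ _)
  · exact le_rfl

lemma sum_publicProb_eq_sum_protocolProb (v : Fin (r + m) → Fin n → ZMod 2)
    (A : ∀ j, QubitAttack (ι j)) (P : BitPartition n nz nx) (p : (Fin nx → ZMod 2) → Prop)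
    [DecidablePred p] :
    (∑ ξ, ∑ cz, ∑ cb, if p cb then publicProb v A P ξ cz cb else 0) =
      ∑ i, ∑ iB, if p ((i + iB) ∘ testXPos P) then protocolProb A P i iB else 0 := by
  have hfiber := sum_ite_sum_ite_eq (fun t : (Fin r → ZMod 2) × (Fin nz → ZMod 2) ×
      (Fin nx → ZMod 2) => p t.2.2)
    (fun u : (Fin (n + nz + nx) → ZMod 2) × (Fin (n + nz + nx) → ZMod 2) =>
      (Matrix.vecMul (u.1 ∘ infoPos P) (parityMatrix v).transpose,
        (u.1 + u.2) ∘ testZPos P, (u.1 + u.2) ∘ testXPos P))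
    fun u => protocolProb A P u.1 u.2
  simp only [Fintype.sum_prod_type, Prod.mk.injEq] at hfiber
  exact hfiber

lemma sum_protocolProb_add (A : ∀ j, QubitAttack (ι j)) (P : BitPartition n nz nx)
    (c : Fin (n + nz + nx) → ZMod 2) :
    ∑ i, protocolProb A P i (i + c) =
      (Fintype.card (BitPartition n nz nx) : ℝ)⁻¹ * ∏ j, (A j).flipProb (P.1.2.2 j) (c j) := by
  simp only [protocolProb, outcomeProb_eq_prod, QubitAttack.flipProb, Pi.add_apply, mul_assoc,
    ← Finset.mul_sum, Finset.prod_mul_distrib, Fintype.prod_sum, Finset.prod_const,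
    Finset.card_univ, Fintype.card_fin, one_div, inv_pow]

lemma sum_publicProb (v : Fin (r + m) → Fin n → ZMod 2) (A : ∀ j, QubitAttack (ι j))
    (P : BitPartition n nz nx) (p : (Fin nx → ZMod 2) → Prop) [DecidablePred p] :
    (∑ ξ, ∑ cz, ∑ cb, if p cb then publicProb v A P ξ cz cb else 0) =
      (Fintype.card (BitPartition n nz nx) : ℝ)⁻¹ *
        errorProb (fun a => A (testXPos P a)) 1 p := by
  have hshift (i : Fin (n + nz + nx) → ZMod 2) :
      (∑ iB, if p ((i + iB) ∘ testXPos P) then protocolProb A P i iB else 0) =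
        ∑ c with p (c ∘ testXPos P), protocolProb A P i (i + c) := by
    rw [Finset.sum_filter, ← Equiv.sum_comp (Equiv.addLeft i)]
    refine Finset.sum_congr rfl fun c _ => ?_
    have hcancel : i + (i + c) = c := funext fun j => CharTwo.add_cancel_left (i j) (c j)
    rw [Equiv.coe_addLeft, hcancel]
  have hmarginal := productProb_comp_of_injective (positions_injective _ P.2.2.2.1)
    (fun j => (A j).sum_flipProb (P.1.2.2 j)) p
  rw [sum_publicProb_eq_sum_protocolProb, Finset.sum_congr rfl fun i _ => hshift i,
    Finset.sum_comm, Finset.sum_congr rfl fun c _ => sum_protocolProb_add A P c, ← Finset.mul_sum,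
    errorProb, ← P.testX_comp_testXPos]
  exact congrArg _ hmarginal

lemma eveKeyState_eq (v : Fin (r + m) → Fin n → ZMod 2) (A : ∀ j, QubitAttack (ι j))
    (P : BitPartition n nz nx) (ξ : Fin r → ZMod 2) (k : Fin m → ZMod 2) :
    eveKeyState v A P ξ k = ((2 : ℂ) ^ (n - (r + m)))⁻¹ •
      ∑ x ∈ parityCoset v (Fin.append ξ k), eveState (fun a => A (infoPos P a)) 0 x := by
  have hmem (x : Fin n → ZMod 2) : x ∈ parityCoset v (Fin.append ξ k) ↔
      Matrix.vecMul x (parityMatrix v).transpose = ξ ∧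
        Matrix.vecMul x (keyMatrix v).transpose = k := by
    simp only [mem_parityCoset, Fin.forall_fin_add, Fin.append_left, Fin.append_right, funext_iff]
    rfl
  simp only [eveKeyState, P.testX_comp_infoPos, ← hmem, Finset.sum_ite_mem, Finset.univ_inter]

lemma deltaEve_le {v : Fin (r + m) → Fin n → ZMod 2} (hv : LinearIndependent (ZMod 2) v)
    (A : ∀ j, QubitAttack (ι j)) (paz pax : ℝ) {t : ℝ}
    (ht : ∀ u : Fin n → ZMod 2, (hammingNorm u : ℝ) ≤ 2 * t →
      (hammingNorm u : ℕ∞) < keyDist r m v) (k k' : Fin m → ZMod 2) (P : BitPartition n nz nx)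
    (ξ : Fin r → ZMod 2) (cz : Fin nz → ZMod 2) (cb : Fin nx → ZMod 2) :
    deltaEve v A paz pax k k' P ξ cz cb ≤ if (hammingNorm cb : ℝ) / nx ≤ pax then
      2 * √(errorProb (fun a => A (infoPos P a)) 1 fun c => t < (hammingNorm c : ℝ)) else 0 := by
  have htrace := traceNorm_sum_parityCoset_sub_le hv (fun a => A (infoPos P a)) ht ξ k k'
  rw [← eveKeyState_eq, ← eveKeyState_eq] at htrace
  rw [deltaEve]
  split_ifs with hpass hx hx
  · linarith
  · exact absurd hpass.2 hx
  · positivity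
  · exact le_rfl

lemma errorProb_infoPos_mul_errorProb_testXPos (A : ∀ j, QubitAttack (ι j))
    (P : BitPartition n nz nx) (p : (Fin n → ZMod 2) → Prop) (q : (Fin nx → ZMod 2) → Prop)
    [DecidablePred p] [DecidablePred q] :
    errorProb (fun a => A (infoPos P a)) 1 p * errorProb (fun a => A (testXPos P a)) 1 q =
      errorProb A 1 fun c => p (c ∘ infoPos P) ∧ q (c ∘ testXPos P) :=
  (productProb_comp_and_comp (positions_injective _ P.2.1) (positions_injective _ P.2.2.2.1)
    P.infoPos_ne_testXPos (fun j => (A j).sum_flipProb 1) p q).symm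

lemma sum_inv_card_mul_sqrt_le {α : Type*} [Fintype α] {f : α → ℝ} (hf : ∀ a, 0 ≤ f a) :
    ∑ a, (Fintype.card α : ℝ)⁻¹ * √(f a) ≤ √(∑ a, (Fintype.card α : ℝ)⁻¹ * f a) := by
  calc ∑ a, (Fintype.card α : ℝ)⁻¹ * √(f a)
      = ∑ a, √(Fintype.card α : ℝ)⁻¹ * √((Fintype.card α : ℝ)⁻¹ * f a) :=
        Finset.sum_congr rfl fun a _ => by
          rw [Real.sqrt_mul (by positivity), ← mul_assoc, Real.mul_self_sqrt (by positivity)]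
    _ ≤ √(∑ _a : α, (Fintype.card α : ℝ)⁻¹) * √(∑ a, (Fintype.card α : ℝ)⁻¹ * f a) :=
        Real.sum_sqrt_mul_sqrt_le _ (fun _ => by positivity) fun a =>
          mul_nonneg (by positivity) (hf a)
    _ ≤ √(∑ a, (Fintype.card α : ℝ)⁻¹ * f a) := by
        refine mul_le_of_le_one_left (Real.sqrt_nonneg _) (Real.sqrt_le_one.2 ?_)
        rw [Finset.sum_const, nsmul_eq_mul, Finset.card_univ]
        exact mul_inv_le_one

/-- For the partition `P`, the probability that the test on the TEST-X bits is passed, although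
the INFO bits would have shown more than `(pax + ε) * n` errors in the `x` basis. -/
def undetectedProb (A : ∀ j, QubitAttack (ι j)) (pax ε : ℝ) (P : BitPartition n nz nx) : ℝ :=
  errorProb A 1 fun c => (pax + ε) * n < (hammingNorm (c ∘ infoPos P) : ℝ) ∧
    (hammingNorm (c ∘ testXPos P) : ℝ) / nx ≤ pax

lemma sum_inv_card_mul_undetectedProb_le (A : ∀ j, QubitAttack (ι j)) (pax : ℝ) {ε : ℝ}
    (hε : 0 ≤ ε) (hn : 0 < n) (hnx : 0 < nx) :
    ∑ P : BitPartition n nz nx, (Fintype.card (BitPartition n nz nx) : ℝ)⁻¹ *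
        undetectedProb A pax ε P ≤
      Real.exp (-(2 * (((nx : ℝ) / (n + nx)) ^ 2 * n * ε ^ 2))) := by
  set E := Real.exp (-(2 * (((nx : ℝ) / (n + nx)) ^ 2 * n * ε ^ 2)))
  have hcard (c : Fin (n + nz + nx) → ZMod 2) :
      (Finset.card {P : BitPartition n nz nx |
        (pax + ε) * n < (hammingNorm (c ∘ infoPos P) : ℝ) ∧
          (hammingNorm (c ∘ testXPos P) : ℝ) / nx ≤ pax} : ℝ) ≤
        Fintype.card (BitPartition n nz nx) * E := by
    refine le_trans ?_ (BitPartition.card_filter_le_errorRateExcess_le hn hnx hε c)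
    gcongr with P
    rintro ⟨hinfo, htest⟩
    have hrate := (lt_div_iff₀ (Nat.cast_pos.2 hn)).2 hinfo
    rw [BitPartition.errorRateExcess]
    linarith
  calc ∑ P : BitPartition n nz nx, (Fintype.card (BitPartition n nz nx) : ℝ)⁻¹ *
        undetectedProb A pax ε P
      ≤ (Fintype.card (BitPartition n nz nx) : ℝ)⁻¹ *
          (Fintype.card (BitPartition n nz nx) * E) := by
        rw [← Finset.mul_sum]
        gcongr
        exact sum_productProb_le (fun j => (A j).flipProb_nonneg 1) (fun j => (A j).sum_flipProb 1)
          hcard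
    _ ≤ E := by
        rw [← mul_assoc]
        exact mul_le_of_le_one_left (Real.exp_pos _).le inv_mul_le_one

lemma expectedDelta_le_sum_sqrt {v : Fin (r + m) → Fin n → ZMod 2}
    (hv : LinearIndependent (ZMod 2) v) (A : ∀ j, QubitAttack (ι j)) (paz pax ε : ℝ)
    (hd : ∀ u : Fin n → ZMod 2, (hammingNorm u : ℝ) ≤ 2 * ((pax + ε) * n) →
      (hammingNorm u : ℕ∞) < keyDist r m v) (k k' : Fin m → ZMod 2) :
    expectedDelta v A paz pax k k' ≤
      2 * ∑ P : BitPartition n nz nx, (Fintype.card (BitPartition n nz nx) : ℝ)⁻¹ *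
        √(undetectedProb A pax ε P) := by
  rw [expectedDelta, Finset.mul_sum]
  refine Finset.sum_le_sum fun P _ => ?_
  set q := errorProb (fun a => A (infoPos P a)) 1 fun c => (pax + ε) * n < (hammingNorm c : ℝ)
  set T := errorProb (fun a => A (testXPos P a)) 1 fun c => (hammingNorm c : ℝ) / nx ≤ pax
  have hqT : q * T = undetectedProb A pax ε P := errorProb_infoPos_mul_errorProb_testXPos A P _ _
  have hT : T ≤ √T := Real.le_sqrt_of_sq_le <|
    pow_le_of_le_one (errorProb_nonneg _ _ _) (errorProb_le_one _ _ _) two_ne_zero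
  calc ∑ ξ, ∑ cz, ∑ cb, deltaEve v A paz pax k k' P ξ cz cb * publicProb v A P ξ cz cb
      ≤ ∑ ξ, ∑ cz, ∑ cb, (if (hammingNorm cb : ℝ) / nx ≤ pax then 2 * √q else 0) *
          publicProb v A P ξ cz cb := by
        gcongr with ξ _ cz _ cb _
        exacts [publicProb_nonneg v A P ξ cz cb, deltaEve_le hv A paz pax hd k k' P ξ cz cb]
    _ = 2 * √q * ((Fintype.card (BitPartition n nz nx) : ℝ)⁻¹ * T) := by
        rw [← sum_publicProb v]
        simp only [Finset.mul_sum, mul_ite, ite_mul, mul_zero, zero_mul]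
    _ = 2 * ((Fintype.card (BitPartition n nz nx) : ℝ)⁻¹ * (√q * T)) := by ring
    _ ≤ 2 * ((Fintype.card (BitPartition n nz nx) : ℝ)⁻¹ * √(undetectedProb A pax ε P)) := by
        rw [← hqT, Real.sqrt_mul (errorProb_nonneg _ _ _)]
        gcongr

lemma expectedDelta_le {v : Fin (r + m) → Fin n → ZMod 2} (hv : LinearIndependent (ZMod 2) v)
    (A : ∀ j, QubitAttack (ι j)) (paz : ℝ) {pax ε : ℝ} (hε : 0 ≤ ε) (hn : 0 < n) (hnx : 0 < nx)
    (hd : ∀ u : Fin n → ZMod 2, (hammingNorm u : ℝ) ≤ 2 * ((pax + ε) * n) →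
      (hammingNorm u : ℕ∞) < keyDist r m v) (k k' : Fin m → ZMod 2) :
    expectedDelta v A paz pax k k' ≤
      2 * Real.exp (-(((nx : ℝ) / (n + nx)) ^ 2 * n * ε ^ 2)) := by
  set x := ((nx : ℝ) / (n + nx)) ^ 2 * n * ε ^ 2
  calc expectedDelta v A paz pax k k'
      ≤ 2 * ∑ P : BitPartition n nz nx, (Fintype.card (BitPartition n nz nx) : ℝ)⁻¹ *
          √(undetectedProb A pax ε P) := expectedDelta_le_sum_sqrt hv A paz pax ε hd k k'
    _ ≤ 2 * √(∑ P : BitPartition n nz nx, (Fintype.card (BitPartition n nz nx) : ℝ)⁻¹ *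
          undetectedProb A pax ε P) := by
        gcongr
        exact sum_inv_card_mul_sqrt_le fun P => errorProb_nonneg _ _ _
    _ ≤ 2 * √(Real.exp (-(2 * x))) := by
        gcongr
        exact sum_inv_card_mul_undetectedProb_le A pax hε hn hnx
    _ = 2 * Real.exp (-x) := by
        rw [← Real.exp_half]
        ring_nf

lemma expectedDelta_self (v : Fin (r + m) → Fin n → ZMod 2) (A : ∀ j, QubitAttack (ι j))
    (paz pax : ℝ) (k : Fin m → ZMod 2) : expectedDelta v A paz pax k k = 0 := by
  simp only [expectedDelta, deltaEve, sub_self, traceNorm_zero, mul_zero, ite_self, zero_mul,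
    Finset.sum_const_zero]

lemma lt_keyDist_of_ofReal_lt_div {v : Fin (r + m) → Fin n → ZMod 2} {δ : ℝ} (hn : 0 < n)
    (hd : ENNReal.ofReal δ < (keyDist r m v : ℝ≥0∞) / (n : ℝ≥0∞)) {l : ℕ} (hl : (l : ℝ) ≤ δ * n) :
    (l : ℕ∞) < keyDist r m v := by
  have hn0 : (n : ℝ≥0∞) ≠ 0 := Nat.cast_ne_zero.2 hn.ne'
  rw [ENNReal.lt_div_iff_mul_lt (Or.inl hn0) (Or.inl (ENNReal.natCast_ne_top n))] at hd
  have hl' : (l : ℝ≥0∞) ≤ ENNReal.ofReal δ * n := by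
    rw [← ENNReal.ofReal_natCast l, ← ENNReal.ofReal_natCast n,
      ← ENNReal.ofReal_mul' (Nat.cast_nonneg n)]
    exact ENNReal.ofReal_le_ofReal hl
  exact_mod_cast hl'.trans_lt hd

end Protocol

end BB84InfoZ

end

theorem mainTheorem2_general {n nz nx r m : ℕ} {v : Fin (r + m) → Fin n → ZMod 2}
    (hv : LinearIndependent (ZMod 2) v) (paz : ℝ) {pax ε : ℝ}
    (hd : ENNReal.ofReal (2 * (pax + ε)) < (BB84InfoZ.keyDist r m v : ℝ≥0∞) / (n : ℝ≥0∞))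
    (hε : 0 ≤ ε) (hn : 0 < n) (hnx : 0 < nx) {ι : Fin (n + nz + nx) → Type*}
    [∀ j, Fintype (ι j)] [∀ j, DecidableEq (ι j)] (A : ∀ j, BB84InfoZ.QubitAttack (ι j))
    (k k' : Fin m → ZMod 2) :
    BB84InfoZ.expectedDelta v A paz pax k k' ≤
      2 * min (m : ℝ) 1 * Real.exp (-(((nx : ℝ) / (n + nx)) ^ 2 * n * ε ^ 2)) := by
  obtain rfl | hm := Nat.eq_zero_or_pos m
  · rw [Subsingleton.elim k k', BB84InfoZ.expectedDelta_self]
    positivity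
  · rw [min_eq_right (Nat.one_le_cast.2 hm), mul_one]
    exact BB84InfoZ.expectedDelta_le hv A paz hε hn hnx
      (fun u hu => BB84InfoZ.lt_keyDist_of_ofReal_lt_div hn hd (hu.trans_eq (mul_assoc _ _ _).symm))
      k k'

theorem mainTheorem2 (δ R : ℝ) (hδ : 0 < δ) (hR : 0 < R)
    (S : Set ℕ) (r m : ℕ → ℕ) (v : ∀ n, Fin (r n + m n) → Fin n → ZMod 2)
    (hv : ∀ n ∈ S, LinearIndependent (ZMod 2) (v n))
    (hd : ∀ n ∈ S, ENNReal.ofReal δ < (BB84InfoZ.keyDist (r n) (m n) (v n) : ℝ≥0∞) / (n : ℝ≥0∞))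
    (hm : ∀ n ∈ S, (m n : ℝ) / (n : ℝ) ≤ R)
    (paz pax ε : ℝ) (hpaz : 0 < paz) (hpax : 0 < pax) (hε : 0 < ε) (hδε : pax + ε ≤ δ / 2)
    (n nz nx : ℕ) (hnS : n ∈ S) (hn : 0 < n) (hnz : 0 < nz) (hnx : 0 < nx)
    {ι : Fin (n + nz + nx) → Type*} [∀ j, Fintype (ι j)] [∀ j, DecidableEq (ι j)]
    (A : ∀ j, BB84InfoZ.QubitAttack (ι j)) (k k' : Fin (m n) → ZMod 2) :
    BB84InfoZ.expectedDelta (v n) A paz pax k k' ≤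
      2 * R * (n : ℝ) * Real.exp (-(((nx : ℝ) / ((n : ℝ) + (nx : ℝ))) ^ 2 * (n : ℝ) * ε ^ 2)) := by
  have hdist := (ENNReal.ofReal_le_ofReal (by linarith : 2 * (pax + ε) ≤ δ)).trans_lt (hd n hnS)
  have hmR : min (m n : ℝ) 1 ≤ R * n :=
    (min_le_left _ _).trans ((div_le_iff₀ (Nat.cast_pos.2 hn)).1 (hm n hnS))
  rw [mul_assoc 2 R]
  exact (mainTheorem2_general (hv n hnS) paz hdist hε.le hn hnx A k k').trans (by gcongr)
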